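/- Theorem 1. Let $n,\ell\in\mathbb N$, let $\mathcal F$ be a non-empty two-universal class of functions $\{0,1\}^n\to\{0,1\}^\ell$ (that is, $\Pr_{f\in_R\mathcal F}[f(x)=f(y)]\le 2^{-\ell}$ for all $x\ne y$), and let $\log$ be the logarithm to base $2$. Consider the following protocol with an honest sender. She picks $X\in\{0,1\}^n$ and $\Theta\in\{+,\times\}^n$ uniformly at random and sends the BB84 states $|X_1\rangle_{\Theta_1},\dots,|X_n\rangle_{\Theta_n}$. At the reveal time she sends $\Theta$ and two functions $F_+,F_\times$ chosen independently and uniformly from $\mathcal F$. She outputs $S_b=F_b(X_{|\mathcal I_b})$ for $b\in\{+,\times\}$, where $X_{|\mathcal I_b}$ is the substring of $X$ on $\mathcal I_b=\{i\mid\Theta_i=b\}$, padded with zeros to length $n$. The dishonest receiver is limited to individual-storage attacks on finite-dimensional systems. On reception he applies to each qubit $i$ separately an arbitrary (partial) measurement with classical outcome $K_i$. The remaining quantum system of qubit $i$ undergoes a quantum operation $\mathcal N_i$ (the storage noise), which gives the register $E_i$. After the reveal he applies an arbitrary joint quantum operation to $\Theta,F_+,F_\times,K_1,\dots,K_n,E_1,\dots,E_n$,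 which results in his final register $B$. Let $t\in\mathbb R$ be such that the states right before the reveal satisfy $$H(X_i\mid\Theta_iK_iE_i)=H(\rho_{X_i\Theta_iK_iE_i})-H(\rho_{\Theta_iK_iE_i})\ge t\qquad\text{for all } i=1,\dots,n,$$ where $H$ is the von Neumann entropy. Let $\varepsilon>0$, and suppose that $$n\ge\tfrac85\log\frac{2}{\varepsilon^4}\qquad\text{and}\qquad \ell\le\tfrac14(t-\delta)n+\tfrac12-\log\frac1\varepsilon,\qquad\text{where } \delta=8\sqrt{\log(2/\varepsilon^4)/n}.$$ Then the protocol is $2\varepsilon$-secure against this receiver: there is a random variable $D\in\{+,\times\}$ (that is, a joint state $\rho_{DS_+S_\times B}$, classical on $D,S_+,S_\times$, which gives back the state $\rho_{S_+S_\times B}$ of the protocol when $D$ is traced out) such that, with $\overline D$ the basis different from $D$, $$d(S_{\overline D}\mid S_D\,D\,B)\le 2\varepsilon .$$ Here $d(Y|R)=\frac12\big\|\mathsf{id}_Y/|\mathcal Y|\otimes\rho_R-\rho_{YR}\big\|_1$ is the non-uniformity of a classical variable $Y$ with values in the finite set $\mathcal Y$, given a register $R$, and $\|A\|_1=\operatorname{Tr}\sqrt{A^\dagger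 A}$. -/

import Mathlib

open scoped Kronecker BigOperators ComplexOrder

noncomputable section

namespace NoisyStorage

/-! ### Finite-dimensional quantum information

Operators on a finite-dimensional Hilbert space with a fixed orthonormal basis indexed by `a` are
matrices `Matrix a a ℂ`; a composite system is indexed by the product of the index types. -/

section QuantumInformation

variable {a b c e : Type} [Fintype a] [Fintype b] [Fintype c] [Fintype e]
  [DecidableEq a] [DecidableEq b] [DecidableEq c] [DecidableEq e]

/-- The trace norm `‖A‖₁ = Tr √(A† A)`: the sum of the square roots of the eigenvalues of `A† A`. -/
def traceNorm (A : Matrix a a ℂ) : ℝ :=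
  ∑ i, Real.sqrt ((Matrix.isHermitian_conjTranspose_mul_self A).eigenvalues i)

/-- The von Neumann entropy `H(ρ) = -Tr (ρ log₂ ρ)`, computed from the eigenvalues of the Hermitian
operator `ρ` (it is only applied to density operators). -/
def vonNeumannEntropy (ρ : Matrix a a ℂ) : ℝ :=
  if h : ρ.IsHermitian then -∑ i, h.eigenvalues i * Real.logb 2 (h.eigenvalues i) else 0

/-- The partial trace over the first system. -/
def partialTraceFst (ρ : Matrix (a × b) (a × b) ℂ) : Matrix b b ℂ :=
  Matrix.of fun i j => ∑ x, ρ (x, i) (x, j)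

/-- The conditional von Neumann entropy `H(A|B) = H(ρ_AB) - H(ρ_B)`. -/
def condEntropy (ρ : Matrix (a × b) (a × b) ℂ) : ℝ :=
  vonNeumannEntropy ρ - vonNeumannEntropy (partialTraceFst ρ)

/-- The operator `∑ x, |x⟩⟨x| ⊗ f x`, classical on the first register. -/
def cqState (f : c → Matrix e e ℂ) : Matrix (c × e) (c × e) ℂ :=
  ∑ x, Matrix.single x x (1 : ℂ) ⊗ₖ f x

/-- The non-uniformity `d(X|E) = ½ ‖ id_X / |X| ⊗ ρ_E - ∑ x, |x⟩⟨x| ⊗ f x ‖₁`, where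
`f x = P_X(x) ρ_E^x` and `ρ_E = ∑ x, f x`. -/
def nonUniformity (f : c → Matrix e e ℂ) : ℝ :=
  1 / 2 * traceNorm
    (((Fintype.card c : ℂ)⁻¹ • (1 : Matrix c c ℂ)) ⊗ₖ (∑ x, f x) - cqState f)

/-- The tensor product of finitely many operators. -/
def tensorFamily {n : ℕ} {d : Fin n → ℕ}
    (M : ∀ i, Matrix (Fin (d i)) (Fin (d i)) ℂ) :
    Matrix (∀ i, Fin (d i)) (∀ i, Fin (d i)) ℂ :=
  Matrix.of fun p q => ∏ i, M i (p i) (q i)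

end QuantumInformation

/-- A quantum operation (completely positive trace-preserving map) from the system `a` to the
system `b`, in Kraus form. -/
structure Channel (a b : Type) [Fintype a] [DecidableEq a] [Fintype b] where
  /-- the number of Kraus operators -/
  num : ℕ
  /-- the Kraus operators -/
  kraus : Fin num → Matrix b a ℂ
  /-- trace preservation -/
  complete : ∑ j, (kraus j).conjTranspose * kraus j = 1

/-- The action `ρ ↦ ∑ j, K_j ρ K_j†` of a quantum operation. -/
def Channel.apply {a b : Type} [Fintype a] [DecidableEq a] [Fintype b]
    (N : Channel a b) (ρ : Matrix a a ℂ) : Matrix b b ℂ :=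
  ∑ j, N.kraus j * ρ * (N.kraus j).conjTranspose

/-- A (partial) measurement of the system `a` with classical outcomes in `k` and post-measurement
system `b`: a completely positive map for each outcome, in Kraus form, which are jointly
trace-preserving. -/
structure Measurement (a b k : Type) [Fintype a] [DecidableEq a] [Fintype b] [Fintype k] where
  /-- the number of Kraus operators for each outcome -/
  num : ℕ
  /-- the Kraus operators for each outcome -/
  kraus : k → Fin num → Matrix b a ℂ
  /-- joint trace preservation -/
  complete : ∑ x, ∑ j, (kraus x j).conjTranspose * kraus x j = 1

/-- The unnormalized post-measurement operator for the outcome `x`: its trace is the probability of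
`x`, and its normalization is the post-measurement state. -/
def Measurement.apply {a b k : Type} [Fintype a] [DecidableEq a] [Fintype b] [Fintype k]
    (P : Measurement a b k) (x : k) (ρ : Matrix a a ℂ) : Matrix b b ℂ :=
  ∑ j, P.kraus x j * ρ * (P.kraus x j).conjTranspose

/-! ### BB84 states, hashing and the sender's outputs -/

/-- The two BB84 bases: `plus` is the computational and `cross` the Hadamard basis. -/
inductive Basis
  | plus
  | cross
  deriving DecidableEq

instance : Fintype Basis where
  elems := {.plus, .cross}
  complete := by
    rintro (_ | _) <;> simp

/-- The basis different from the given one. -/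
def Basis.other : Basis → Basis
  | .plus => .cross
  | .cross => .plus

/-- The BB84 vector `|x⟩_θ`. -/
def bb84Ket : Fin 2 → Basis → (Fin 2 → ℂ)
  | 0, .plus => ![1, 0]
  | 1, .plus => ![0, 1]
  | 0, .cross => ![1 / (Real.sqrt 2 : ℂ), 1 / (Real.sqrt 2 : ℂ)]
  | 1, .cross => ![1 / (Real.sqrt 2 : ℂ), -1 / (Real.sqrt 2 : ℂ)]

/-- The BB84 state `|x⟩⟨x|_θ`. -/
def bb84 (x : Fin 2) (θ : Basis) : Matrix (Fin 2) (Fin 2) ℂ :=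
  Matrix.vecMulVec (bb84Ket x θ) (star (bb84Ket x θ))

/-- Bit strings of length `n`. -/
abbrev BitString (n : ℕ) : Type := Fin n → Fin 2

/-- A class of functions `{0,1}^n → {0,1}^ℓ` is two-universal if for all `x ≠ y` and `f` uniform in
the class, `Pr[f x = f y] ≤ 2^{-ℓ}`. -/
def TwoUniversal {n ℓ : ℕ} (𝓕 : Finset (BitString n → BitString ℓ)) : Prop :=
  ∀ x y : BitString n, x ≠ y →
    ((𝓕.filter fun f => f x = f y).card : ℝ) / (𝓕.card : ℝ) ≤ (2 : ℝ)⁻¹ ^ ℓ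

/-- The positions `{i | θ_i = b}`. -/
def positions {n : ℕ} (θ : Fin n → Basis) (b : Basis) : Finset (Fin n) :=
  Finset.univ.filter fun i => θ i = b

/-- The substring of `x` on the positions in `T`, padded at the end with zeros to length `n`. -/
def restrictPad {n : ℕ} (x : BitString n) (T : Finset (Fin n)) : BitString n :=
  fun j => if h : (j : ℕ) < T.card then x (T.orderEmbOfFin rfl ⟨j, h⟩) else 0

/-- Equality of pairs of hash functions is decidable (a shortcut for instance search). -/
instance {n ℓ : ℕ} (𝓕 : Finset (BitString n → BitString ℓ)) : DecidableEq (Basis → 𝓕) :=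
  fun f g => inferInstanceAs (Decidable (f = g))

/-! ### Individual-storage attacks -/

/-- A strategy of a dishonest receiver limited to individual-storage attacks, in the protocol with
`n` qubits and hash functions from `𝓕`. The `i`-th qubit is measured by `measure i` on reception;
the remaining quantum system undergoes the noise `noise i` until the reveal time. After the bases
and the two hash functions have been revealed, the receiver applies an arbitrary (coherent)
operation `final` to everything he holds: bases, hash functions, measurement outcomes and the
stored systems. -/
structure IndividualStorageAttack {n ℓ : ℕ} (𝓕 : Finset (BitString n → BitString ℓ)) where
  /-- the number of outcomes of the initial measurement of the `i`-th qubit -/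
  outcomes : Fin n → ℕ
  /-- the dimension of the `i`-th post-measurement system -/
  postDim : Fin n → ℕ
  /-- the dimension of the `i`-th stored system after the noise -/
  storeDim : Fin n → ℕ
  /-- the dimension of the final system of the receiver -/
  finalDim : ℕ
  /-- the initial (partial) measurements -/
  measure : ∀ i, Measurement (Fin 2) (Fin (postDim i)) (Fin (outcomes i))
  /-- the storage noise -/
  noise : ∀ i, Channel (Fin (postDim i)) (Fin (storeDim i))
  /-- the operation after the reveal time -/
  final : Channel
    ((Fin n → Basis) × (Basis → 𝓕) × (∀ i, Fin (outcomes i)) × (∀ i, Fin (storeDim i)))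
    (Fin finalDim)

namespace IndividualStorageAttack

variable {n ℓ : ℕ} {𝓕 : Finset (BitString n → BitString ℓ)} (A : IndividualStorageAttack 𝓕)

/-- The operator `¼ p_{k|xθ} 𝒩_i(ρ_{xθ}^k)` of the `i`-th stored system. -/
def roundOp (i : Fin n) (x : Fin 2) (θ : Basis) (k : Fin (A.outcomes i)) :
    Matrix (Fin (A.storeDim i)) (Fin (A.storeDim i)) ℂ :=
  (1 / 4 : ℂ) • (A.noise i).apply ((A.measure i).apply k (bb84 x θ))

/-- The state `ρ_{X_i Θ_i K_i E_i}` of the `i`-th round right before the reveal time. -/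
def roundState (i : Fin n) :
    Matrix (Fin 2 × Basis × Fin (A.outcomes i) × Fin (A.storeDim i))
      (Fin 2 × Basis × Fin (A.outcomes i) × Fin (A.storeDim i)) ℂ :=
  cqState fun x => cqState fun θ => cqState fun k => A.roundOp i x θ k

/-- `t` is an uncertainty lower bound for the attack if `H(X_i | Θ_i K_i E_i) ≥ t` for all `i`. -/
def IsUncertaintyLowerBound (t : ℝ) : Prop :=
  ∀ i, t ≤ condEntropy (A.roundState i)

/-- The unnormalized state of the receiver's registers `Θ`, `(F_+, F_×)`, `K`, `E` after the reveal,
for a fixed value of the sender's string `X = x`; the state of `X Θ K E` is the tensor product of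
the states of the rounds, and `F_+`, `F_×` are independent and uniform in `𝓕`. Only the terms are
kept for which the sender's outputs `S_b = F_b(x restricted to the positions with basis b)` are
equal to the given strings `s b`. -/
def revealedOp (s : Basis → BitString ℓ) (x : BitString n) :
    Matrix ((Fin n → Basis) × (Basis → 𝓕) × (∀ i, Fin (A.outcomes i)) × (∀ i, Fin (A.storeDim i)))
      ((Fin n → Basis) × (Basis → 𝓕) × (∀ i, Fin (A.outcomes i)) × (∀ i, Fin (A.storeDim i))) ℂ :=
  cqState fun θ => cqState fun f : Basis → 𝓕 => cqState fun k =>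
    if ∀ b, (f b : BitString n → BitString ℓ) (restrictPad x (positions θ b)) = s b then
      ((𝓕.card : ℂ)⁻¹ ^ 2) • tensorFamily fun i => A.roundOp i (x i) (θ i) (k i)
    else 0

/-- The final joint state `ρ_{S_+ S_× B}` of the sender's outputs and the receiver's system: the
operator `Pr[S = s] ρ_B^s` for each value `s = (s_+, s_×)`. -/
def finalState (s : Basis → BitString ℓ) : Matrix (Fin A.finalDim) (Fin A.finalDim) ℂ :=
  A.final.apply (∑ x, A.revealedOp s x)

end IndividualStorageAttack

/-- Given the joint cq-state `σ` of a random variable `D`, of the strings `S_+, S_×` and of a quantum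
register `B` (so that `σ d s = Pr[D = d, S = s] ρ_B^{d,s}`), the operators that describe the
string `S_{D̄}` (argument `u`) jointly with the registers `S_D`, `D` and `B`. -/
def otherGivenChosen {ℓ m : ℕ}
    (σ : Basis → (Basis → BitString ℓ) → Matrix (Fin m) (Fin m) ℂ) (u : BitString ℓ) :
    Matrix (BitString ℓ × Basis × Fin m) (BitString ℓ × Basis × Fin m) ℂ :=
  cqState fun v => cqState fun d => σ d fun b => if b = d then v else u

/-- Security with error `ε` for a joint state `ρ_{S_+ S_× B}` of the sender's outputs and the
dishonest receiver's system: there is a random variable `D` (that is, a cq-state `σ` of `D`, `S_+`,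
`S_×` and `B` which gives back the original state when `D` is traced out) such that
`d(S_{D̄} | S_D D B) ≤ ε`. -/
def SecureAgainstReceiver {ℓ m : ℕ}
    (ρ : (Basis → BitString ℓ) → Matrix (Fin m) (Fin m) ℂ) (ε : ℝ) : Prop :=
  ∃ σ : Basis → (Basis → BitString ℓ) → Matrix (Fin m) (Fin m) ℂ,
    (∀ d s, (σ d s).PosSemidef) ∧ (∀ s, ∑ d, σ d s = ρ s) ∧
      nonUniformity (otherGivenChosen σ) ≤ ε

end NoisyStorage

end

/-! Fix the bases θ and the outcomes k. The state of `X` and the stored systems is then a product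
over the rounds, and `S_b` depends only on the bits at the positions with basis b. The proof is
privacy amplification measured by the Petz-Rényi quantity Tr ρ^(1+s) σ^(-s), with s small. This
quantity is exactly multiplicative over rounds, so neither smoothing nor a concentration argument is
needed.

Privacy amplification (`SpectralFamily.sum_traceNorm_hash_le`): hashing a family to ℓ bits leaves a
deviation of order √(2^(ℓs) · total · renyi). Hashing only the substring on T, given everything else
(`sum_traceNorm_hash_of_disjoint_le`), costs √(total · renyi) for each round in T and the bare trace
for each other round.

Choice of D: either string may be the one that leaks less. Each round belongs to exactly one of the
two substrings, so the product of the two leakages no longer depends on how θ splits the rounds. Let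
D be the basis whose complementary string leaks less. The smaller leakage is at most the geometric
mean (`leakage_chosenBasis_le`), which is a product over rounds, so the sum over θ and k factorizes.
Two uses of Cauchy-Schwarz give the fourth root of the Rényi quantity of each round, which is the
origin of the factor 1/4 in the rate.

Entropy: expanding the Rényi quantity of a round at s = 0 gives at most exp(3s² - s t ln 2)
(`renyi_le`, `sum_renyi_roundFamily_le`). The receiver's last operation only contracts the trace
norm. The choice s = √(L/n)/4 with L = log(2/ε⁴) finishes the proof (`error_exponent_le`). -/

noncomputable section

namespace NoisyStorage

/-! ### The Frobenius norm and the trace norm -/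

section TraceNorm

variable {a b c m k : Type} [Fintype a] [Fintype b] [Fintype c] [Fintype m] [Fintype k]

/-- The square of the Frobenius norm. -/
def frobSq (B : Matrix a b ℂ) : ℝ := ∑ i, ∑ j, ‖B i j‖ ^ 2

lemma frobSq_nonneg (B : Matrix a b ℂ) : 0 ≤ frobSq B := by
  unfold frobSq; positivity

lemma trace_conjTranspose_mul_self (B : Matrix a b ℂ) :
    (B.conjTranspose * B).trace = (frobSq B : ℂ) := by
  simp only [Matrix.trace, Matrix.diag, Matrix.mul_apply, Matrix.conjTranspose_apply, frobSq]
  rw [Finset.sum_comm]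
  push_cast
  refine Finset.sum_congr rfl fun i _ => Finset.sum_congr rfl fun j _ => ?_
  rw [← Complex.conj_mul']
  rfl

lemma frobSq_conjTranspose (B : Matrix a b ℂ) : frobSq B.conjTranspose = frobSq B := by
  unfold frobSq
  rw [Finset.sum_comm]
  simp [Matrix.conjTranspose_apply]

lemma frobSq_mul_of_conjTranspose_mul [DecidableEq b] {U : Matrix a b ℂ}
    (hU : U.conjTranspose * U = 1) (B : Matrix b c ℂ) : frobSq (U * B) = frobSq B := by
  have : ((frobSq (U * B) : ℝ) : ℂ) = (frobSq B : ℝ) := by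
    rw [← trace_conjTranspose_mul_self, ← trace_conjTranspose_mul_self,
      Matrix.conjTranspose_mul, Matrix.mul_assoc, ← Matrix.mul_assoc U.conjTranspose, hU,
      Matrix.one_mul]
  exact_mod_cast this

lemma frobSq_mul_unitary [DecidableEq b] {U : Matrix b c ℂ}
    (hU : U * U.conjTranspose = 1) (B : Matrix a b ℂ) : frobSq (B * U) = frobSq B := by
  rw [← frobSq_conjTranspose, Matrix.conjTranspose_mul,
    frobSq_mul_of_conjTranspose_mul (by simpa using hU), frobSq_conjTranspose]

lemma norm_trace_mul_le (B : Matrix a b ℂ) (C : Matrix b a ℂ) :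
    ‖(B * C).trace‖ ≤ Real.sqrt (frobSq B) * Real.sqrt (frobSq C) := by
  have h := Real.sum_mul_le_sqrt_mul_sqrt (Finset.univ : Finset (a × b))
    (fun p => ‖B p.1 p.2‖) (fun p => ‖C p.2 p.1‖)
  simp only [Fintype.sum_prod_type] at h
  have h2 : frobSq C = ∑ x, ∑ y, ‖C y x‖ ^ 2 := by
    unfold frobSq; rw [Finset.sum_comm]
  rw [h2]
  refine le_trans ?_ h
  simp only [Matrix.trace, Matrix.diag, Matrix.mul_apply]
  refine (norm_sum_le _ _).trans (Finset.sum_le_sum fun i _ => ?_)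
  refine (norm_sum_le _ _).trans (Finset.sum_le_sum fun j _ => ?_)
  rw [norm_mul]

/-- A square matrix has a unitary `V` and a partial isometry `W` with `A V = W diag σ`, where the
`σ i` are the square roots of the eigenvalues of `A† A`. -/
lemma exists_partial_isometry [DecidableEq a] (A : Matrix a a ℂ) :
    ∃ (V W : Matrix a a ℂ) (σ p : a → ℝ), V.conjTranspose * V = 1 ∧ V * V.conjTranspose = 1 ∧
      (∀ i, 0 ≤ σ i) ∧ traceNorm A = ∑ i, σ i ∧ A * V = W * Matrix.diagonal (fun i => (σ i : ℂ)) ∧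
      W.conjTranspose * W = Matrix.diagonal (fun i => (p i : ℂ)) ∧
      (∀ i, p i ≤ 1) ∧ (∀ i, p i * σ i = σ i) ∧ W * (W.conjTranspose * W) = W := by
  classical
  set h := Matrix.isHermitian_conjTranspose_mul_self A
  set V : Matrix a a ℂ := h.eigenvectorUnitary.1
  have hV1 : V.conjTranspose * V = 1 := Unitary.coe_star_mul_self h.eigenvectorUnitary
  have hV2 : V * V.conjTranspose = 1 := Unitary.coe_mul_star_self h.eigenvectorUnitary
  have hnn : ∀ i, 0 ≤ h.eigenvalues i := Matrix.eigenvalues_conjTranspose_mul_self_nonneg A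
  set σ : a → ℝ := fun i => Real.sqrt (h.eigenvalues i) with hσ
  have hσσ : ∀ i, σ i * σ i = h.eigenvalues i := fun i => Real.mul_self_sqrt (hnn i)
  -- Since 0⁻¹ = 0, this is the pseudo-inverse of diag σ. Hence `A * V * D` is a partial isometry
  -- whose initial projection has the entries σ⁻¹σ ∈ {0, 1}.
  set D : Matrix a a ℂ := Matrix.diagonal (fun i => ((σ i)⁻¹ : ℂ)) with hD
  have hG : (A * V).conjTranspose * (A * V) =
      Matrix.diagonal (fun i => (h.eigenvalues i : ℂ)) := by
    have := h.conjStarAlgAut_star_eigenvectorUnitary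
    rw [Unitary.conjStarAlgAut_star_apply] at this
    rw [Matrix.conjTranspose_mul, Matrix.mul_assoc, ← Matrix.mul_assoc A.conjTranspose,
      ← Matrix.mul_assoc]
    exact this
  have hWW : (A * V * D).conjTranspose * (A * V * D) =
      Matrix.diagonal (fun i => (((σ i)⁻¹ * σ i : ℝ) : ℂ)) := by
    rw [Matrix.conjTranspose_mul, Matrix.mul_assoc, ← Matrix.mul_assoc (A * V).conjTranspose, hG,
      hD, Matrix.diagonal_conjTranspose, Matrix.diagonal_mul_diagonal,
      Matrix.diagonal_mul_diagonal]
    congr 1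
    funext i
    rw [← hσσ i]
    by_cases h0 : σ i = 0
    · simp [h0]
    · have h0' : (σ i : ℂ) ≠ 0 := by exact_mod_cast h0
      simp only [Pi.star_apply, star_inv₀, RCLike.star_def, Complex.conj_ofReal]
      push_cast
      field_simp
  -- The columns that the pseudo-inverse discards are already zero, so multiplying back by diag σ
  -- recovers `A * V`.
  have hcol : ∀ i j, σ j = 0 → (A * V) i j = 0 := by
    intro i j hj
    have h1 := congrFun (congrFun hG j) j
    rw [Matrix.diagonal_apply_eq, ← hσσ j, hj, Matrix.mul_apply] at h1
    have h2 : ∑ x, ‖(A * V) x j‖ ^ 2 = 0 := by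
      have : ((∑ x, ‖(A * V) x j‖ ^ 2 : ℝ) : ℂ) = 0 := by
        push_cast
        simp only [mul_zero, Complex.ofReal_zero] at h1
        rw [← h1]
        refine Finset.sum_congr rfl fun x _ => ?_
        rw [← Complex.conj_mul']
        rfl
      exact_mod_cast this
    have h3 := (Finset.sum_eq_zero_iff_of_nonneg (fun x _ => by positivity)).1 h2 i
      (Finset.mem_univ _)
    simpa using h3
  refine ⟨V, A * V * D, σ, fun i => (σ i)⁻¹ * σ i, hV1, hV2, fun i => Real.sqrt_nonneg _, rfl,
    ?_, hWW, fun i => ?_, fun i => ?_, ?_⟩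
  · ext i j
    rw [Matrix.mul_diagonal, hD, Matrix.mul_diagonal]
    by_cases h0 : σ j = 0
    · simp [h0, hcol i j h0]
    · have h0' : (σ j : ℂ) ≠ 0 := by exact_mod_cast h0
      field_simp
  · exact inv_mul_le_one
  · by_cases h0 : σ i = 0
    · simp [h0]
    · field_simp
  · rw [hWW]
    ext i j
    rw [Matrix.mul_diagonal, hD, Matrix.mul_diagonal]
    by_cases h0 : σ j = 0
    · simp [h0]
    · have h0' : (σ j : ℂ) ≠ 0 := by exact_mod_cast h0
      push_cast
      field_simp

/-- Pythagoras: W W† is an orthogonal projection, so ‖B‖² = ‖W†B‖² + ‖B - W W†B‖². -/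
lemma frobSq_conjTranspose_mul_le_of_partial_isometry [DecidableEq a] {W : Matrix a a ℂ}
    (hW : W * (W.conjTranspose * W) = W) (B : Matrix a b ℂ) :
    frobSq (W.conjTranspose * B) ≤ frobSq B := by
  have h : ((frobSq B : ℝ) : ℂ) = (frobSq (W.conjTranspose * B) : ℝ) +
      (frobSq (B - W * (W.conjTranspose * B)) : ℝ) := by
    rw [← trace_conjTranspose_mul_self, ← trace_conjTranspose_mul_self,
      ← trace_conjTranspose_mul_self, ← Matrix.trace_add]
    congr 1
    have e : W * (W.conjTranspose * (W * (W.conjTranspose * B))) = W * (W.conjTranspose * B) := by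
      rw [← Matrix.mul_assoc W.conjTranspose W, ← Matrix.mul_assoc W, hW]
    simp only [Matrix.conjTranspose_sub, Matrix.conjTranspose_mul, Matrix.conjTranspose_conjTranspose,
      Matrix.sub_mul, Matrix.mul_sub, Matrix.mul_assoc, e]
    abel
  have h' : frobSq B = frobSq (W.conjTranspose * B) + frobSq (B - W * (W.conjTranspose * B)) := by
    exact_mod_cast h
  linarith [frobSq_nonneg (B - W * (W.conjTranspose * B))]

lemma traceNorm_nonneg [DecidableEq a] (A : Matrix a a ℂ) : 0 ≤ traceNorm A :=
  Finset.sum_nonneg fun _ _ => Real.sqrt_nonneg _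

/-- The Cauchy–Schwarz inequality for the trace norm. -/
lemma traceNorm_mul_le [DecidableEq a] (B : Matrix a m ℂ) (C : Matrix m a ℂ) :
    traceNorm (B * C) ≤ Real.sqrt (frobSq B) * Real.sqrt (frobSq C) := by
  obtain ⟨V, W, σ, p, hV1, hV2, hσ, htr, hAV, hWW, hp, hpσ, hW⟩ := exists_partial_isometry (B * C)
  -- Polar decomposition turns the trace norm into a trace, to which the Cauchy-Schwarz inequality
  -- for the Hilbert-Schmidt product applies.
  have h1 : ((traceNorm (B * C) : ℝ) : ℂ) = ((W.conjTranspose * B) * (C * V)).trace := by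
    rw [Matrix.mul_assoc, ← Matrix.mul_assoc B, hAV, ← Matrix.mul_assoc, hWW,
      Matrix.diagonal_mul_diagonal, Matrix.trace_diagonal, htr]
    push_cast
    refine Finset.sum_congr rfl fun i _ => ?_
    exact_mod_cast (hpσ i).symm
  have h2 := norm_trace_mul_le (W.conjTranspose * B) (C * V)
  rw [← h1, Complex.norm_real, Real.norm_of_nonneg (traceNorm_nonneg _),
    frobSq_mul_unitary hV2] at h2
  refine h2.trans ?_
  gcongr
  exact frobSq_conjTranspose_mul_le_of_partial_isometry hW B

/-- Together with `exists_factor` this characterizes ‖A‖₁ as the least r such that A = B C with both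
squared Frobenius norms at most r. The trace norm inequalities for sums, channels and block-diagonal
operators follow by building factorizations. -/
lemma traceNorm_le_of_factor [DecidableEq a] {A : Matrix a a ℂ} {r : ℝ} (B : Matrix a m ℂ)
    (C : Matrix m a ℂ) (h : A = B * C) (hB : frobSq B ≤ r) (hC : frobSq C ≤ r) :
    traceNorm A ≤ r := by
  have hr : 0 ≤ r := (frobSq_nonneg B).trans hB
  calc traceNorm A ≤ Real.sqrt (frobSq B) * Real.sqrt (frobSq C) := h ▸ traceNorm_mul_le B C
    _ ≤ Real.sqrt r * Real.sqrt r := by gcongr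
    _ = r := Real.mul_self_sqrt hr

/-- The singular values are shared evenly between the factors: A = (W √σ)(√σ V†). -/
lemma exists_factor [DecidableEq a] (A : Matrix a a ℂ) :
    ∃ B C : Matrix a a ℂ, A = B * C ∧ frobSq B ≤ traceNorm A ∧ frobSq C ≤ traceNorm A := by
  obtain ⟨V, W, σ, p, hV1, hV2, hσ, htr, hAV, hWW, hp, hpσ, hW⟩ := exists_partial_isometry A
  set R : Matrix a a ℂ := Matrix.diagonal (fun i => ((Real.sqrt (σ i) : ℝ) : ℂ)) with hR
  have hRR : R * R = Matrix.diagonal (fun i => (σ i : ℂ)) := by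
    rw [hR, Matrix.diagonal_mul_diagonal]
    congr 1
    funext i
    rw [← Complex.ofReal_mul, Real.mul_self_sqrt (hσ i)]
  have hRH : R.conjTranspose = R := by
    rw [hR, Matrix.diagonal_conjTranspose]
    congr 1
    funext i
    simp
  refine ⟨W * R, R * V.conjTranspose, ?_, ?_, ?_⟩
  · rw [Matrix.mul_assoc, ← Matrix.mul_assoc R, hRR, ← Matrix.mul_assoc, ← hAV, Matrix.mul_assoc,
      hV2, Matrix.mul_one]
  · have : ((frobSq (W * R) : ℝ) : ℂ) = ((∑ i, σ i : ℝ) : ℂ) := by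
      rw [← trace_conjTranspose_mul_self, Matrix.conjTranspose_mul, Matrix.mul_assoc,
        ← Matrix.mul_assoc W.conjTranspose, hWW, hRH, hR, Matrix.diagonal_mul_diagonal,
        Matrix.diagonal_mul_diagonal, Matrix.trace_diagonal]
      push_cast
      refine Finset.sum_congr rfl fun i _ => ?_
      rw [← mul_assoc, mul_comm _ (p i : ℂ), mul_assoc, ← Complex.ofReal_mul,
        Real.mul_self_sqrt (hσ i)]
      exact_mod_cast hpσ i
    rw [htr]
    exact_mod_cast this.le
  · have : ((frobSq (R * V.conjTranspose) : ℝ) : ℂ) = ((∑ i, σ i : ℝ) : ℂ) := by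
      rw [frobSq_mul_unitary (by simpa using hV1), ← trace_conjTranspose_mul_self, hRH, hRR,
        Matrix.trace_diagonal]
      push_cast
      rfl
    rw [htr]
    exact_mod_cast this.le

lemma traceNorm_zero [DecidableEq a] : traceNorm (0 : Matrix a a ℂ) = 0 :=
  le_antisymm (traceNorm_le_of_factor (0 : Matrix a a ℂ) (0 : Matrix a a ℂ) (by simp)
    (by simp [frobSq]) (by simp [frobSq])) (traceNorm_nonneg _)

/-- A completely positive trace-preserving map in Kraus form contracts the trace norm. -/
lemma traceNorm_sum_mul_mul_le [DecidableEq a] [DecidableEq b] {ι : Type} [Fintype ι]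
    (K : ι → Matrix b a ℂ) (A : Matrix a a ℂ)
    (hK : ∑ i, (K i).conjTranspose * K i = 1) :
    traceNorm (∑ i, K i * A * (K i).conjTranspose) ≤ traceNorm A := by
  obtain ⟨B, C, hA, hB, hC⟩ := exists_factor A
  have key : ∀ X : Matrix a a ℂ, ∑ i, frobSq (K i * X) = frobSq X := by
    intro X
    have : ((∑ i, frobSq (K i * X) : ℝ) : ℂ) = (frobSq X : ℝ) := by
      push_cast
      simp_rw [← trace_conjTranspose_mul_self]
      rw [← Matrix.trace_sum]
      congr 1
      simp_rw [Matrix.conjTranspose_mul, Matrix.mul_assoc]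
      rw [← Matrix.mul_sum]
      simp_rw [← Matrix.mul_assoc]
      rw [← Matrix.sum_mul, hK, Matrix.one_mul]
    exact_mod_cast this
  -- The blocks `K i * B` form one wide row and the blocks `C * (K i)†` one tall column. By `hK` the
  -- Frobenius norms of B and C are preserved.
  refine traceNorm_le_of_factor (m := ι × a)
    (Matrix.of fun x p => (K p.1 * B) x p.2)
    (Matrix.of fun p x => (C * (K p.1).conjTranspose) p.2 x) ?_ ?_ ?_
  · ext x y
    rw [Matrix.mul_apply, Fintype.sum_prod_type, Matrix.sum_apply]
    refine Finset.sum_congr rfl fun i _ => ?_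
    rw [hA, ← Matrix.mul_assoc, Matrix.mul_assoc _ C, Matrix.mul_apply]
    rfl
  · refine le_trans (le_of_eq ?_) hB
    rw [← key B]
    unfold frobSq
    simp only [Fintype.sum_prod_type, Matrix.of_apply]
    rw [Finset.sum_comm]
  · refine le_trans (le_of_eq ?_) hC
    rw [← frobSq_conjTranspose C, ← key]
    have : ∀ i, frobSq (K i * C.conjTranspose) = frobSq (C * (K i).conjTranspose) := fun i => by
      rw [← frobSq_conjTranspose]; simp
    simp_rw [this]
    unfold frobSq
    simp only [Fintype.sum_prod_type, Matrix.of_apply]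

lemma traceNorm_channel_le [DecidableEq a] [DecidableEq b] (N : Channel a b) (A : Matrix a a ℂ) :
    traceNorm (N.apply A) ≤ traceNorm A :=
  traceNorm_sum_mul_mul_le N.kraus A N.complete

/-- The triangle inequality for the trace norm. -/
lemma traceNorm_sum_le [DecidableEq a] {ι : Type} (s : Finset ι) (A : ι → Matrix a a ℂ) :
    traceNorm (∑ i ∈ s, A i) ≤ ∑ i ∈ s, traceNorm (A i) := by
  choose B C hA hB hC using fun i => exists_factor (A i)
  -- Row-times-column block stacking again: squared Frobenius norms of stacked blocks add up.
  refine traceNorm_le_of_factor (m := s × a)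
    (Matrix.of fun x p => B p.1 x p.2) (Matrix.of fun p x => C p.1 p.2 x) ?_ ?_ ?_
  · ext x y
    rw [Matrix.mul_apply, Fintype.sum_prod_type, Matrix.sum_apply, ← Finset.sum_coe_sort s]
    refine Finset.sum_congr rfl fun i _ => ?_
    rw [hA i, Matrix.mul_apply]
    rfl
  · refine le_trans (le_of_eq ?_) (Finset.sum_le_sum fun i _ => hB i)
    unfold frobSq
    simp only [Fintype.sum_prod_type, Matrix.of_apply]
    rw [Finset.sum_comm, ← Finset.sum_coe_sort s]
  · refine le_trans (le_of_eq ?_) (Finset.sum_le_sum fun i _ => hC i)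
    unfold frobSq
    simp only [Fintype.sum_prod_type, Matrix.of_apply]
    rw [← Finset.sum_coe_sort s]

lemma traceNorm_add_le [DecidableEq a] (A B : Matrix a a ℂ) :
    traceNorm (A + B) ≤ traceNorm A + traceNorm B := by
  have := traceNorm_sum_le (Finset.univ : Finset (Fin 2)) ![A, B]
  simpa [Fin.sum_univ_two] using this

lemma frobSq_smul (z : ℂ) (B : Matrix a b ℂ) : frobSq (z • B) = ‖z‖ ^ 2 * frobSq B := by
  simp [frobSq, Finset.mul_sum, mul_pow]

lemma traceNorm_smul_le [DecidableEq a] (z : ℂ) (A : Matrix a a ℂ) :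
    traceNorm (z • A) ≤ ‖z‖ * traceNorm A := by
  obtain ⟨B, C, hA, hB, hC⟩ := exists_factor A
  calc traceNorm (z • A) = traceNorm ((z • B) * C) := by rw [Matrix.smul_mul, ← hA]
    _ ≤ _ := traceNorm_mul_le _ _
    _ ≤ Real.sqrt (‖z‖ ^ 2 * traceNorm A) * Real.sqrt (traceNorm A) := by
        rw [frobSq_smul]; gcongr
    _ = ‖z‖ * traceNorm A := by
        rw [Real.sqrt_mul (by positivity), Real.sqrt_sq (norm_nonneg _), mul_assoc,
          Real.mul_self_sqrt (traceNorm_nonneg _)]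

/-! ### Block-diagonal (classical-quantum) operators. -/

lemma cqState_apply {a c : Type} [Fintype c] [DecidableEq c] (f : c → Matrix a a ℂ) (p q : c × a) :
    cqState f p q = if p.1 = q.1 then f p.1 p.2 q.2 else 0 := by
  obtain ⟨x, i⟩ := p
  obtain ⟨y, j⟩ := q
  rw [cqState, Matrix.sum_apply]
  simp only [Matrix.kroneckerMap_apply, Matrix.single_apply]
  rw [Finset.sum_eq_single x]
  · by_cases h : x = y <;> simp [h]
  · intro z _ hz
    simp [hz]
  · simp

lemma cqState_mul [DecidableEq c] (f g : c → Matrix a a ℂ) :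
    cqState f * cqState g = cqState fun x => f x * g x := by
  ext ⟨x, i⟩ ⟨y, j⟩
  simp only [Matrix.mul_apply, Fintype.sum_prod_type, cqState_apply]
  rw [Finset.sum_eq_single x]
  · by_cases h : x = y <;> simp [h]
  · intro z _ hz
    simp [Ne.symm hz]
  · simp

lemma frobSq_cqState [DecidableEq c] (f : c → Matrix a a ℂ) :
    frobSq (cqState f) = ∑ x, frobSq (f x) := by
  simp only [frobSq, Fintype.sum_prod_type, cqState_apply]
  refine Finset.sum_congr rfl fun x _ => Finset.sum_congr rfl fun i _ => ?_
  rw [Finset.sum_eq_single x]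
  · simp
  · intro z _ hz
    simp [Ne.symm hz]
  · simp

lemma traceNorm_cqState_le [DecidableEq a] [DecidableEq c] (f : c → Matrix a a ℂ) :
    traceNorm (cqState f) ≤ ∑ x, traceNorm (f x) := by
  choose B C hA hB hC using fun i => exists_factor (f i)
  refine traceNorm_le_of_factor (cqState B) (cqState C) ?_ ?_ ?_
  · rw [cqState_mul]
    congr 1
    funext x
    exact hA x
  · rw [frobSq_cqState]; exact Finset.sum_le_sum fun i _ => hB i
  · rw [frobSq_cqState]; exact Finset.sum_le_sum fun i _ => hC i

end TraceNorm

/-! ### Two-universal hashing -/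

section Hashing

variable {X Y Φ : Type} [Fintype X] [Fintype Y] [Fintype Φ] [DecidableEq X] [DecidableEq Y]

/-- The deviation of the indicator of `y = u` from its average over `u`. -/
def hashCoeff (y u : Y) : ℝ := (Fintype.card Y : ℝ)⁻¹ - if y = u then 1 else 0

lemma sum_hashCoeff_mul [Nonempty Y] (y y' : Y) :
    ∑ u, hashCoeff y u * hashCoeff y' u =
      (if y = y' then 1 else 0) - (Fintype.card Y : ℝ)⁻¹ := by
  have hN : (Fintype.card Y : ℝ) ≠ 0 := by exact_mod_cast Fintype.card_ne_zero
  have : ∀ u, hashCoeff y u * hashCoeff y' u =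
      (Fintype.card Y : ℝ)⁻¹ * (Fintype.card Y : ℝ)⁻¹
        - (Fintype.card Y : ℝ)⁻¹ * (if y = u then 1 else 0)
        - (Fintype.card Y : ℝ)⁻¹ * (if y' = u then 1 else 0)
        + (if y = u then (if y' = u then 1 else 0) else 0) := by
    intro u
    unfold hashCoeff
    split_ifs <;> ring
  simp_rw [this]
  rw [Finset.sum_add_distrib, Finset.sum_sub_distrib, Finset.sum_sub_distrib]
  simp only [← Finset.mul_sum, Finset.sum_const, Finset.card_univ, nsmul_eq_mul, Finset.sum_ite_eq,
    Finset.mem_univ, if_true]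
  have : (if y' = y then (1 : ℝ) else 0) = if y = y' then 1 else 0 := by simp [eq_comm]
  rw [this]
  field_simp
  ring

lemma sum_abs_hashCoeff_le [Nonempty Y] (y : Y) : ∑ u, |hashCoeff y u| ≤ 2 := by
  have hN : (Fintype.card Y : ℝ) ≠ 0 := by exact_mod_cast Fintype.card_ne_zero
  calc ∑ u, |hashCoeff y u| ≤ ∑ u, ((Fintype.card Y : ℝ)⁻¹ + if y = u then 1 else 0) := by
        refine Finset.sum_le_sum fun u _ => ?_
        unfold hashCoeff
        refine (abs_sub _ _).trans ?_
        gcongr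
        · rw [abs_of_nonneg (by positivity)]
        · split_ifs <;> simp
    _ = 2 := by
        rw [Finset.sum_add_distrib]
        simp only [Finset.sum_const, Finset.card_univ, nsmul_eq_mul, Finset.sum_ite_eq,
          Finset.mem_univ, if_true]
        field_simp
        norm_num

/-- The collision bound of a two-universal class `g`. -/
def CollisionBound (g : Φ → X → Y) : Prop :=
  ∀ x x', x ≠ x' → ((Finset.univ.filter fun φ => g φ x = g φ x').card : ℝ) ≤
    Fintype.card Φ * (Fintype.card Y : ℝ)⁻¹

/-- The left side is a positive semidefinite quadratic form with kernel K(x,x') = #collisions -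
|Φ|/|Y|. Two-universality makes the off-diagonal entries nonpositive, but they need not vanish.
Positivity of the form at |z| shows that the off-diagonal part is at most the diagonal part in
absolute value. This is the source of the factor 2. -/
lemma sum_sq_hashCoeff_le [Nonempty Y] {g : Φ → X → Y} (hg : CollisionBound g) (z : X → ℝ) :
    ∑ φ, ∑ u, (∑ x, hashCoeff (g φ x) u * z x) ^ 2 ≤ 2 * Fintype.card Φ * ∑ x, z x ^ 2 := by
  set K : X → X → ℝ := fun x x' => ∑ φ, ∑ u, hashCoeff (g φ x) u * hashCoeff (g φ x') u with hK
  have hKeq : ∀ x x', K x x' =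
      (Finset.univ.filter fun φ => g φ x = g φ x').card
        - Fintype.card Φ * (Fintype.card Y : ℝ)⁻¹ := by
    intro x x'
    simp only [hK, sum_hashCoeff_mul, Finset.sum_sub_distrib, Finset.sum_const, Finset.card_univ,
      nsmul_eq_mul, Finset.sum_boole]
  have hexp : ∀ w : X → ℝ, ∑ φ, ∑ u, (∑ x, hashCoeff (g φ x) u * w x) ^ 2 =
      ∑ x, ∑ x', K x x' * (w x * w x') := by
    intro w
    have : ∀ φ u, (∑ x, hashCoeff (g φ x) u * w x) ^ 2 =
        ∑ x, ∑ x', hashCoeff (g φ x) u * hashCoeff (g φ x') u * (w x * w x') := by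
      intro φ u
      rw [sq, Finset.sum_mul_sum]
      refine Finset.sum_congr rfl fun x _ => Finset.sum_congr rfl fun x' _ => by ring
    simp_rw [this, hK, Finset.sum_mul]
    rw [Finset.sum_congr rfl fun φ _ => Finset.sum_comm, Finset.sum_comm]
    refine Finset.sum_congr rfl fun x _ => ?_
    rw [Finset.sum_congr rfl fun φ _ => Finset.sum_comm, Finset.sum_comm]
  have hdiag : ∀ x, K x x ≤ Fintype.card Φ := by
    intro x
    rw [hKeq]
    have : ((Finset.univ.filter fun φ : Φ => g φ x = g φ x).card : ℝ) = Fintype.card Φ := by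
      simp
    rw [this]
    have : 0 ≤ (Fintype.card Φ : ℝ) * (Fintype.card Y : ℝ)⁻¹ := by positivity
    linarith
  have hoff : ∀ x x', x ≠ x' → K x x' ≤ 0 := by
    intro x x' h
    rw [hKeq]
    linarith [hg x x' h]
  -- Equality holds on the diagonal; off it, K ≤ 0 and -|zz'| ≤ zz'. The subtracted term sums to the
  -- quadratic form at |z|, a sum of squares that can be dropped.
  have h1 : ∀ x x', K x x' * (z x * z x') ≤
      (if x = x' then 2 * K x x * z x ^ 2 else 0) - K x x' * (|z x| * |z x'|) := by
    intro x x'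
    split_ifs with h
    · subst h
      rw [abs_mul_abs_self]
      nlinarith
    · rw [← abs_mul]
      nlinarith [hoff x x' h, neg_abs_le (z x * z x')]
  rw [hexp]
  calc ∑ x, ∑ x', K x x' * (z x * z x')
      ≤ ∑ x, ∑ x', ((if x = x' then 2 * K x x * z x ^ 2 else 0) - K x x' * (|z x| * |z x'|)) :=
        Finset.sum_le_sum fun x _ => Finset.sum_le_sum fun x' _ => h1 x x'
    _ = ∑ x, 2 * K x x * z x ^ 2
          - ∑ φ, ∑ u, (∑ x, hashCoeff (g φ x) u * |z x|) ^ 2 := by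
        rw [hexp fun x => |z x|]
        simp only [Finset.sum_sub_distrib, Finset.sum_ite_eq, Finset.mem_univ, if_true]
    _ ≤ ∑ x, 2 * K x x * z x ^ 2 := sub_le_self _ (by positivity)
    _ ≤ ∑ x, 2 * Fintype.card Φ * z x ^ 2 := by
        refine Finset.sum_le_sum fun x _ => ?_
        have := hdiag x
        gcongr
    _ = _ := by rw [Finset.mul_sum]

lemma sum_frobSq_hashCoeff_le [Nonempty Y] {a b : Type} [Fintype a] [Fintype b] {g : Φ → X → Y}
    (hg : CollisionBound g) (A : X → Matrix a b ℂ) :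
    ∑ φ, ∑ u, frobSq (∑ x, (hashCoeff (g φ x) u : ℂ) • A x) ≤
      2 * Fintype.card Φ * ∑ x, frobSq (A x) := by
  -- The coefficients are real, so the scalar bound applies to the real and imaginary parts of each
  -- entry.
  have hent : ∀ i j, ∑ φ, ∑ u, ‖(∑ x, (hashCoeff (g φ x) u : ℂ) • A x) i j‖ ^ 2 ≤
      2 * Fintype.card Φ * ∑ x, ‖A x i j‖ ^ 2 := by
    intro i j
    have e : ∀ w : ℂ, ‖w‖ ^ 2 = w.re ^ 2 + w.im ^ 2 := fun w => by
      rw [← Complex.normSq_eq_norm_sq, Complex.normSq_apply]; ring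
    have h1 := sum_sq_hashCoeff_le hg fun x => (A x i j).re
    have h2 := sum_sq_hashCoeff_le hg fun x => (A x i j).im
    simp only [e, Matrix.sum_apply, Matrix.smul_apply, smul_eq_mul, Complex.re_sum, Complex.im_sum,
      Complex.re_ofReal_mul, Complex.im_ofReal_mul, Finset.sum_add_distrib, mul_add]
    exact add_le_add h1 h2
  calc ∑ φ, ∑ u, frobSq (∑ x, (hashCoeff (g φ x) u : ℂ) • A x)
      = ∑ i, ∑ j, ∑ φ, ∑ u, ‖(∑ x, (hashCoeff (g φ x) u : ℂ) • A x) i j‖ ^ 2 := by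
        unfold frobSq
        rw [Finset.sum_congr rfl fun φ _ => Finset.sum_comm, Finset.sum_comm]
        refine Finset.sum_congr rfl fun i _ => ?_
        rw [Finset.sum_congr rfl fun φ _ => Finset.sum_comm, Finset.sum_comm]
    _ ≤ ∑ i, ∑ j, 2 * Fintype.card Φ * ∑ x, ‖A x i j‖ ^ 2 :=
        Finset.sum_le_sum fun i _ => Finset.sum_le_sum fun j _ => hent i j
    _ = _ := by
        unfold frobSq
        simp only [← Finset.mul_sum]
        congr 1
        rw [Finset.sum_congr rfl fun i _ => Finset.sum_comm, Finset.sum_comm]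

end Hashing

/-! ### Spectral data of a family of operators -/

/-- Diagonalizations `ρ x = U x · diag (lam x) · (U x)†` of a finite family of positive operators and
a diagonalization `V · diag mu · V†` of their sum. -/
structure SpectralFamily (X E : Type) [Fintype X] [Fintype E] [DecidableEq E] where
  /-- the eigenbases of the members -/
  U : X → Matrix E E ℂ
  /-- the eigenbasis of the sum -/
  V : Matrix E E ℂ
  /-- the eigenvalues of the members -/
  lam : X → E → ℝ
  /-- the eigenvalues of the sum -/
  mu : E → ℝ
  star_mul_U : ∀ x, (U x).conjTranspose * U x = 1
  star_mul_V : V.conjTranspose * V = 1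
  lam_nonneg : ∀ x a, 0 ≤ lam x a
  sum_eq : ∑ x, U x * Matrix.diagonal (fun a => (lam x a : ℂ)) * (U x).conjTranspose =
    V * Matrix.diagonal (fun b => (mu b : ℂ)) * V.conjTranspose

namespace SpectralFamily

variable {X E : Type} [Fintype X] [Fintype E] [DecidableEq E] (S : SpectralFamily X E)

/-- The members of the family. -/
def op (x : X) : Matrix E E ℂ :=
  S.U x * Matrix.diagonal (fun a => (S.lam x a : ℂ)) * (S.U x).conjTranspose

/-- The transition matrix between the two eigenbases. -/
def overlap (x : X) : Matrix E E ℂ := S.V.conjTranspose * S.U x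

/-- The transition probabilities between the two eigenbases. -/
def weight (x : X) (b a : E) : ℝ := ‖S.overlap x b a‖ ^ 2

/-- The total trace of the family. -/
def total : ℝ := ∑ x, ∑ a, S.lam x a

/-- The quantity `∑ x, Tr (ρ x ^ (1 + s) σ ^ (-s))`, where `σ = ∑ x, ρ x`. -/
def renyi (s : ℝ) : ℝ := ∑ x, ∑ b, ∑ a, S.weight x b a * S.lam x a * (S.lam x a / S.mu b) ^ s

lemma mul_star_V : S.V * S.V.conjTranspose = 1 := mul_eq_one_comm.1 S.star_mul_V

lemma star_mul_overlap (x : X) : (S.overlap x).conjTranspose * S.overlap x = 1 := by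
  unfold overlap
  rw [Matrix.conjTranspose_mul, Matrix.conjTranspose_conjTranspose, Matrix.mul_assoc,
    ← Matrix.mul_assoc S.V, S.mul_star_V, Matrix.one_mul, S.star_mul_U]

lemma mul_star_overlap (x : X) : S.overlap x * (S.overlap x).conjTranspose = 1 :=
  mul_eq_one_comm.1 (S.star_mul_overlap x)

lemma weight_nonneg (x : X) (b a : E) : 0 ≤ S.weight x b a := by unfold weight; positivity

lemma sum_weight_left (x : X) (a : E) : ∑ b, S.weight x b a = 1 := by
  have h := congrFun (congrFun (S.star_mul_overlap x) a) a
  rw [Matrix.mul_apply, Matrix.one_apply_eq] at h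
  have : ((∑ b, S.weight x b a : ℝ) : ℂ) = 1 := by
    rw [← h]
    push_cast
    refine Finset.sum_congr rfl fun b _ => ?_
    rw [weight, Matrix.conjTranspose_apply]
    push_cast
    rw [← Complex.conj_mul']
    rfl
  exact_mod_cast this

lemma sum_weight_right (x : X) (b : E) : ∑ a, S.weight x b a = 1 := by
  have h := congrFun (congrFun (S.mul_star_overlap x) b) b
  rw [Matrix.mul_apply, Matrix.one_apply_eq] at h
  have : ((∑ a, S.weight x b a : ℝ) : ℂ) = 1 := by
    rw [← h]
    push_cast
    refine Finset.sum_congr rfl fun a _ => ?_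
    rw [weight, Matrix.conjTranspose_apply]
    push_cast
    rw [← Complex.mul_conj']
    rfl
  exact_mod_cast this

lemma sum_overlap :
    ∑ x, S.overlap x * Matrix.diagonal (fun a => (S.lam x a : ℂ)) * (S.overlap x).conjTranspose =
      Matrix.diagonal (fun b => (S.mu b : ℂ)) := by
  have h := congrArg (fun M => S.V.conjTranspose * M * S.V) S.sum_eq
  simp only [Matrix.mul_sum, Matrix.sum_mul] at h
  rw [show S.V.conjTranspose * (S.V * Matrix.diagonal (fun b => (S.mu b : ℂ)) *
      S.V.conjTranspose) * S.V = (S.V.conjTranspose * S.V) *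
      Matrix.diagonal (fun b => (S.mu b : ℂ)) * (S.V.conjTranspose * S.V) by
    simp only [Matrix.mul_assoc], S.star_mul_V, Matrix.one_mul, Matrix.mul_one] at h
  rw [← h]
  refine Finset.sum_congr rfl fun x _ => ?_
  simp only [overlap, Matrix.conjTranspose_mul, Matrix.conjTranspose_conjTranspose,
    Matrix.mul_assoc]

lemma sum_overlap_apply (b b' : E) :
    ∑ x, ∑ a, S.overlap x b a * S.lam x a * star (S.overlap x b' a) =
      if b = b' then (S.mu b : ℂ) else 0 := by
  have h := congrFun (congrFun S.sum_overlap b) b'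
  rw [Matrix.diagonal_apply, Matrix.sum_apply] at h
  rw [← h]
  refine Finset.sum_congr rfl fun x _ => ?_
  rw [Matrix.mul_apply]
  refine Finset.sum_congr rfl fun a _ => ?_
  rw [Matrix.mul_diagonal, Matrix.conjTranspose_apply]

lemma sum_weight_mul_lam (b : E) : ∑ x, ∑ a, S.weight x b a * S.lam x a = S.mu b := by
  have h := S.sum_overlap_apply b b
  rw [if_pos rfl] at h
  have : ((∑ x, ∑ a, S.weight x b a * S.lam x a : ℝ) : ℂ) = S.mu b := by
    rw [← h]
    push_cast
    refine Finset.sum_congr rfl fun x _ => Finset.sum_congr rfl fun a _ => ?_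
    rw [weight]
    push_cast
    rw [← Complex.mul_conj']
    simp only [RCLike.star_def]
    ring
  exact_mod_cast this

lemma mu_nonneg (b : E) : 0 ≤ S.mu b := by
  rw [← S.sum_weight_mul_lam]
  exact Finset.sum_nonneg fun x _ => Finset.sum_nonneg fun a _ =>
    mul_nonneg (S.weight_nonneg x b a) (S.lam_nonneg x a)

lemma weight_mul_lam_le (x : X) (b a : E) : S.weight x b a * S.lam x a ≤ S.mu b := by
  have hnn : ∀ x a, 0 ≤ S.weight x b a * S.lam x a := fun x a =>
    mul_nonneg (S.weight_nonneg x b a) (S.lam_nonneg x a)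
  rw [← S.sum_weight_mul_lam b]
  refine le_trans ?_ (Finset.single_le_sum (f := fun x => ∑ a, S.weight x b a * S.lam x a)
    (fun x _ => Finset.sum_nonneg fun a _ => hnn x a) (Finset.mem_univ x))
  exact Finset.single_le_sum (f := fun a => S.weight x b a * S.lam x a)
    (fun a _ => hnn x a) (Finset.mem_univ a)

/-- The kernel of the sum lies in the kernel of each member. Hence the convention λ/0 = 0 in `renyi`
and in the entropy formula does no harm. -/
lemma weight_mul_lam_eq_zero (x : X) {b : E} (a : E) (h : S.mu b = 0) :
    S.weight x b a * S.lam x a = 0 :=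
  le_antisymm (h ▸ S.weight_mul_lam_le x b a)
    (mul_nonneg (S.weight_nonneg x b a) (S.lam_nonneg x a))

lemma sum_mu : ∑ b, S.mu b = S.total := by
  simp_rw [← S.sum_weight_mul_lam]
  rw [Finset.sum_comm, total]
  refine Finset.sum_congr rfl fun x _ => ?_
  rw [Finset.sum_comm]
  refine Finset.sum_congr rfl fun a _ => ?_
  rw [← Finset.sum_mul, S.sum_weight_left, one_mul]

lemma total_nonneg : 0 ≤ S.total :=
  Finset.sum_nonneg fun x _ => Finset.sum_nonneg fun a _ => S.lam_nonneg x a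

lemma renyi_nonneg (s : ℝ) : 0 ≤ S.renyi s :=
  Finset.sum_nonneg fun x _ => Finset.sum_nonneg fun b _ => Finset.sum_nonneg fun a _ =>
    mul_nonneg (mul_nonneg (S.weight_nonneg x b a) (S.lam_nonneg x a))
      (Real.rpow_nonneg (div_nonneg (S.lam_nonneg x a) (S.mu_nonneg b)) _)

end SpectralFamily

namespace SpectralFamily

variable {X E : Type} [Fintype X] [Fintype E] [DecidableEq E] (S : SpectralFamily X E)

/-! ### Privacy amplification -/

lemma op_eq_mul_overlap (x : X) :
    S.op x = S.V * (S.overlap x * Matrix.diagonal (fun a => (S.lam x a : ℂ))) *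
      (S.U x).conjTranspose := by
  rw [op, overlap]
  simp only [← Matrix.mul_assoc]
  rw [S.mul_star_V, Matrix.one_mul]

open Classical in
/-- The part of the member `x` on the pairs of eigenvectors with ratio of eigenvalues at most
`κ`, as a matrix from the eigenbasis of the member to the one of the sum. -/
def goodPart (κ : ℝ) (x : X) : Matrix E E ℂ :=
  Matrix.of fun b a => if S.lam x a ≤ κ * S.mu b then S.overlap x b a * S.lam x a else 0

open Classical in
/-- The part of the member `x` on the pairs of eigenvectors with ratio of eigenvalues larger than
`κ`. -/
def badPart (κ : ℝ) (x : X) : Matrix E E ℂ :=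
  Matrix.of fun b a => if S.lam x a ≤ κ * S.mu b then 0 else S.overlap x b a * S.lam x a

lemma goodPart_add_badPart (κ : ℝ) (x : X) :
    S.goodPart κ x + S.badPart κ x =
      S.overlap x * Matrix.diagonal (fun a => (S.lam x a : ℂ)) := by
  ext b a
  rw [Matrix.mul_diagonal, Matrix.add_apply, goodPart, badPart, Matrix.of_apply, Matrix.of_apply]
  split_ifs <;> simp

/-- The good part divided by the square roots of the eigenvalues of the sum. -/
def scaledGoodPart (κ : ℝ) (x : X) : Matrix E E ℂ :=
  Matrix.diagonal (fun b => (((Real.sqrt (S.mu b))⁻¹ : ℝ) : ℂ)) * S.goodPart κ x *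
    (S.U x).conjTranspose

/-- Dividing by √μ is reversible on the good part: where μ = 0, the condition λ ≤ κμ forces λ = 0.
-/
lemma sqrt_mul_scaledGoodPart (κ : ℝ) (x : X) :
    Matrix.diagonal (fun b => ((Real.sqrt (S.mu b) : ℝ) : ℂ)) * S.scaledGoodPart κ x =
      S.goodPart κ x * (S.U x).conjTranspose := by
  rw [scaledGoodPart, ← Matrix.mul_assoc, ← Matrix.mul_assoc, Matrix.diagonal_mul_diagonal]
  congr 1
  ext b a
  rw [Matrix.diagonal_mul, goodPart, Matrix.of_apply]
  split_ifs with h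
  · by_cases h0 : S.mu b = 0
    · have : S.lam x a = 0 := le_antisymm (by simpa [h0] using h) (S.lam_nonneg x a)
      simp [this]
    · have : Real.sqrt (S.mu b) ≠ 0 := by
        rw [Real.sqrt_ne_zero (S.mu_nonneg b)]; exact h0
      rw [← Complex.ofReal_mul, mul_inv_cancel₀ this]
      simp
  · simp

/-- A good pair contributes weight · λ · r with r = λ/μ ≤ κ, and r ≤ κ^(1-s) r^s because s ≤ 1. -/
lemma frobSq_scaledGoodPart_le {κ s : ℝ} (hκ : 0 < κ) (hs1 : s ≤ 1) (x : X) :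
    frobSq (S.scaledGoodPart κ x) ≤ κ ^ (1 - s) *
      ∑ b, ∑ a, S.weight x b a * S.lam x a * (S.lam x a / S.mu b) ^ s := by
  rw [scaledGoodPart, frobSq_mul_unitary (by simpa using S.star_mul_U x), frobSq, Finset.mul_sum]
  refine Finset.sum_le_sum fun b _ => ?_
  rw [Finset.mul_sum]
  refine Finset.sum_le_sum fun a _ => ?_
  have hl := S.lam_nonneg x a
  have hm := S.mu_nonneg b
  have hw := S.weight_nonneg x b a
  have hr : 0 ≤ S.lam x a / S.mu b := div_nonneg hl hm
  have hrhs : 0 ≤ κ ^ (1 - s) * (S.weight x b a * S.lam x a * (S.lam x a / S.mu b) ^ s) := by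
    have := Real.rpow_nonneg hr s
    positivity
  rw [Matrix.diagonal_mul, goodPart, Matrix.of_apply]
  split_ifs with h
  · rcases hm.eq_or_lt with h0 | h0
    · simpa [← h0] using hrhs
    · have e : ‖(((Real.sqrt (S.mu b))⁻¹ : ℝ) : ℂ) * (S.overlap x b a * S.lam x a)‖ ^ 2 =
          S.weight x b a * S.lam x a * (S.lam x a / S.mu b) := by
        rw [norm_mul, norm_mul, Complex.norm_real, Complex.norm_real, mul_pow, mul_pow,
          Real.norm_eq_abs, Real.norm_eq_abs, sq_abs, sq_abs, inv_pow, Real.sq_sqrt hm, weight]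
        field_simp
      rw [e]
      rcases hr.eq_or_lt with h1 | h1
      · rw [← h1] at hrhs ⊢
        simpa using hrhs
      · have hrκ : S.lam x a / S.mu b ≤ κ := by rwa [div_le_iff₀ h0]
        calc S.weight x b a * S.lam x a * (S.lam x a / S.mu b)
            = S.weight x b a * S.lam x a *
              ((S.lam x a / S.mu b) ^ (1 - s) * (S.lam x a / S.mu b) ^ s) := by
              rw [← Real.rpow_add h1]; simp
          _ ≤ S.weight x b a * S.lam x a * (κ ^ (1 - s) * (S.lam x a / S.mu b) ^ s) := by
              gcongr
          _ = _ := by ring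
  · simpa using hrhs

/-- The trace norm of the bad part, by the Cauchy–Schwarz inequality. -/
lemma traceNorm_badPart_le {κ s : ℝ} (hκ : 0 < κ) (hs : 0 ≤ s) (x : X) :
    traceNorm (S.V * S.badPart κ x * (S.U x).conjTranspose) ≤
      Real.sqrt (κ ^ (-s) *
        ∑ b, ∑ a, S.weight x b a * S.lam x a * (S.lam x a / S.mu b) ^ s) *
      Real.sqrt (∑ a, S.lam x a) := by
  classical
  -- The factor λ is split as √λ · √λ: one root stays with the bad pairs, the other yields the trace
  -- of the member.
  set B : Matrix E E ℂ := Matrix.of fun b a => if S.lam x a ≤ κ * S.mu b then 0 else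
    S.overlap x b a * (Real.sqrt (S.lam x a) : ℝ) with hB
  set D : Matrix E E ℂ := Matrix.diagonal fun a => ((Real.sqrt (S.lam x a) : ℝ) : ℂ) with hD
  have hfac : S.V * S.badPart κ x * (S.U x).conjTranspose =
      (S.V * B) * (D * (S.U x).conjTranspose) := by
    rw [Matrix.mul_assoc, Matrix.mul_assoc, ← Matrix.mul_assoc B]
    congr 2
    ext b a
    rw [hD, Matrix.mul_diagonal, hB, badPart, Matrix.of_apply, Matrix.of_apply]
    split_ifs
    · simp
    · rw [mul_assoc, ← Complex.ofReal_mul, Real.mul_self_sqrt (S.lam_nonneg x a)]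
  rw [hfac]
  refine (traceNorm_mul_le _ _).trans ?_
  rw [frobSq_mul_of_conjTranspose_mul S.star_mul_V,
    frobSq_mul_unitary (by simpa using S.star_mul_U x)]
  gcongr
  · rw [frobSq, Finset.mul_sum]
    refine Finset.sum_le_sum fun b _ => ?_
    rw [Finset.mul_sum]
    refine Finset.sum_le_sum fun a _ => ?_
    have hl := S.lam_nonneg x a
    have hm := S.mu_nonneg b
    have hw := S.weight_nonneg x b a
    have hr : 0 ≤ S.lam x a / S.mu b := div_nonneg hl hm
    have hrhs : 0 ≤ κ ^ (-s) * (S.weight x b a * S.lam x a * (S.lam x a / S.mu b) ^ s) := by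
      have := Real.rpow_nonneg hr s
      positivity
    rw [hB, Matrix.of_apply]
    split_ifs with h
    · simpa using hrhs
    · have e : ‖S.overlap x b a * ((Real.sqrt (S.lam x a) : ℝ) : ℂ)‖ ^ 2 =
          S.weight x b a * S.lam x a := by
        rw [norm_mul, mul_pow, Complex.norm_real, Real.norm_eq_abs, sq_abs, Real.sq_sqrt hl, weight]
      rw [e]
      rcases hm.eq_or_lt with h0 | h0
      · rw [S.weight_mul_lam_eq_zero x a h0.symm]
        simp
      · have hrκ : κ ≤ S.lam x a / S.mu b := by
          rw [le_div_iff₀ h0]; exact (not_le.1 h).le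
        -- A Markov-type estimate: the ratio exceeds κ on bad pairs.
        have h1 : 1 ≤ κ ^ (-s) * (S.lam x a / S.mu b) ^ s := by
          rw [Real.rpow_neg hκ.le, ← div_eq_inv_mul, one_le_div (by positivity)]
          gcongr
        calc S.weight x b a * S.lam x a = S.weight x b a * S.lam x a * 1 := by ring
          _ ≤ S.weight x b a * S.lam x a * (κ ^ (-s) * (S.lam x a / S.mu b) ^ s) := by gcongr
          _ = _ := by ring
  · rw [frobSq]
    refine Finset.sum_le_sum fun a _ => ?_
    rw [Finset.sum_eq_single a]
    · rw [hD, Matrix.diagonal_apply_eq, Complex.norm_real, Real.norm_eq_abs, sq_abs,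
        Real.sq_sqrt (S.lam_nonneg x a)]
    · intro b _ hb
      rw [hD, Matrix.diagonal_apply_ne _ (Ne.symm hb)]
      simp
    · simp

lemma frobSq_V_mul_sqrt :
    frobSq (S.V * Matrix.diagonal (fun b => ((Real.sqrt (S.mu b) : ℝ) : ℂ))) = S.total := by
  rw [frobSq_mul_of_conjTranspose_mul S.star_mul_V, frobSq, ← S.sum_mu]
  refine Finset.sum_congr rfl fun a _ => ?_
  rw [Finset.sum_eq_single a]
  · rw [Matrix.diagonal_apply_eq, Complex.norm_real, Real.norm_eq_abs, sq_abs,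
      Real.sq_sqrt (S.mu_nonneg a)]
  · intro b _ hb
    rw [Matrix.diagonal_apply_ne _ (Ne.symm hb)]
    simp
  · simp

end SpectralFamily

lemma sum_sqrt_le {ι : Type} [Fintype ι] {f : ι → ℝ} (hf : ∀ i, 0 ≤ f i) :
    ∑ i, Real.sqrt (f i) ≤ Real.sqrt (Fintype.card ι * ∑ i, f i) := by
  have := Real.sum_sqrt_mul_sqrt_le (Finset.univ : Finset ι) (f := fun _ => 1) (g := f)
    (fun _ => zero_le_one) hf
  simpa [Real.sqrt_mul] using this

/-- Privacy amplification against quantum adversaries by two-universal hashing, in terms of a Petz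
Rényi quantity of any order `1 + s`. -/
lemma SpectralFamily.sum_traceNorm_hash_le {X E Y Φ : Type} [Fintype X] [DecidableEq X] [Fintype E]
    [DecidableEq E] [Fintype Y] [DecidableEq Y] [Nonempty Y] [Fintype Φ] (S : SpectralFamily X E)
    {g : Φ → X → Y} (hg : CollisionBound g) {s : ℝ} (hs : 0 ≤ s) (hs1 : s ≤ 1) :
    ∑ φ, ∑ u, traceNorm (∑ x, (hashCoeff (g φ x) u : ℂ) • S.op x) ≤
      Fintype.card Φ * ((2 + Real.sqrt 2) *
        Real.sqrt ((Fintype.card Y : ℝ) ^ s * (S.total * S.renyi s))) := by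
  have hN : 0 < (Fintype.card Y : ℝ) := by exact_mod_cast Fintype.card_pos
  set N : ℝ := (Fintype.card Y : ℝ) with hNdef
  set F : ℝ := (Fintype.card Φ : ℝ) with hFdef
  have hF : 0 ≤ F := by positivity
  -- This threshold balances the two parts: N κ^(1-s) (good) and κ^(-s) (bad) both equal N^s.
  set κ : ℝ := N⁻¹ with hκdef
  have hκ : 0 < κ := inv_pos.2 hN
  set q : X → ℝ := fun x => ∑ b, ∑ a, S.weight x b a * S.lam x a * (S.lam x a / S.mu b) ^ s with hq
  have hqnn : ∀ x, 0 ≤ q x := fun x =>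
    Finset.sum_nonneg fun b _ => Finset.sum_nonneg fun a _ =>
    mul_nonneg (mul_nonneg (S.weight_nonneg x b a) (S.lam_nonneg x a))
      (Real.rpow_nonneg (div_nonneg (S.lam_nonneg x a) (S.mu_nonneg b)) _)
  have hqsum : ∑ x, q x = S.renyi s := rfl
  have hp := S.total_nonneg
  have hQ := S.renyi_nonneg s
  set P : Matrix E E ℂ := S.V * Matrix.diagonal (fun b => ((Real.sqrt (S.mu b) : ℝ) : ℂ)) with hP
  have hsplit : ∀ φ u, ∑ x, (hashCoeff (g φ x) u : ℂ) • S.op x =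
      P * (∑ x, (hashCoeff (g φ x) u : ℂ) • S.scaledGoodPart κ x) +
      ∑ x, (hashCoeff (g φ x) u : ℂ) • (S.V * S.badPart κ x * (S.U x).conjTranspose) := by
    intro φ u
    rw [Matrix.mul_sum, ← Finset.sum_add_distrib]
    refine Finset.sum_congr rfl fun x _ => ?_
    rw [Matrix.mul_smul, ← smul_add, hP, Matrix.mul_assoc, S.sqrt_mul_scaledGoodPart,
      S.op_eq_mul_overlap, ← S.goodPart_add_badPart κ, Matrix.mul_add, Matrix.add_mul,
      Matrix.mul_assoc S.V (S.goodPart κ x)]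
  -- The good part has small second moment, so two-universality is used here, after Cauchy-Schwarz
  -- over the pairs (φ, u). The √2 is the root of the factor in `sum_frobSq_hashCoeff_le`.
  have hgood : ∑ φ, ∑ u, traceNorm (P * (∑ x, (hashCoeff (g φ x) u : ℂ) • S.scaledGoodPart κ x)) ≤
      F * (Real.sqrt 2 * Real.sqrt (N ^ s * (S.total * S.renyi s))) := by
    calc ∑ φ, ∑ u, traceNorm (P * (∑ x, (hashCoeff (g φ x) u : ℂ) • S.scaledGoodPart κ x))
        ≤ ∑ φ, ∑ u, Real.sqrt S.total *
            Real.sqrt (frobSq (∑ x, (hashCoeff (g φ x) u : ℂ) • S.scaledGoodPart κ x)) := by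
          refine Finset.sum_le_sum fun φ _ => Finset.sum_le_sum fun u _ => ?_
          rw [← S.frobSq_V_mul_sqrt]
          exact traceNorm_mul_le _ _
      _ = Real.sqrt S.total * ∑ p : Φ × Y,
            Real.sqrt (frobSq (∑ x, (hashCoeff (g p.1 x) p.2 : ℂ) • S.scaledGoodPart κ x)) := by
          rw [Fintype.sum_prod_type, Finset.mul_sum]
          simp_rw [Finset.mul_sum]
      _ ≤ Real.sqrt S.total * Real.sqrt (F * N * ∑ p : Φ × Y,
            frobSq (∑ x, (hashCoeff (g p.1 x) p.2 : ℂ) • S.scaledGoodPart κ x)) := by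
          gcongr
          have := sum_sqrt_le (ι := Φ × Y) (f := fun p =>
            frobSq (∑ x, (hashCoeff (g p.1 x) p.2 : ℂ) • S.scaledGoodPart κ x))
            (fun p => frobSq_nonneg _)
          simpa [Fintype.card_prod] using this
      _ ≤ Real.sqrt S.total * Real.sqrt (F * N * (2 * F * (κ ^ (1 - s) * S.renyi s))) := by
          gcongr
          rw [Fintype.sum_prod_type]
          refine (sum_frobSq_hashCoeff_le hg _).trans ?_
          have hfs : ∑ x, frobSq (S.scaledGoodPart κ x) ≤ κ ^ (1 - s) * S.renyi s := by
            rw [← hqsum, Finset.mul_sum]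
            exact Finset.sum_le_sum fun x _ => S.frobSq_scaledGoodPart_le hκ hs1 x
          exact mul_le_mul_of_nonneg_left hfs (by positivity)
      _ = F * (Real.sqrt 2 * Real.sqrt (N ^ s * (S.total * S.renyi s))) := by
          have e : N * κ ^ (1 - s) = N ^ s := by
            rw [hκdef, Real.inv_rpow hN.le, ← Real.rpow_neg hN.le]
            nth_rewrite 1 [← Real.rpow_one N]
            rw [← Real.rpow_add hN]
            congr 1
            ring
          rw [← Real.sqrt_mul hp, ← Real.sqrt_mul (by norm_num)]
          conv_rhs => rw [← Real.sqrt_sq hF]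
          rw [← Real.sqrt_mul (by positivity), ← e]
          congr 1
          ring
  -- The bad part is small in trace norm already, so the triangle inequality suffices; the 2 is the
  -- ℓ¹ bound of `hashCoeff`.
  have hbad : ∑ φ, ∑ u, traceNorm
      (∑ x, (hashCoeff (g φ x) u : ℂ) • (S.V * S.badPart κ x * (S.U x).conjTranspose)) ≤
      F * (2 * Real.sqrt (N ^ s * (S.total * S.renyi s))) := by
    have hx : ∑ x, traceNorm (S.V * S.badPart κ x * (S.U x).conjTranspose) ≤
        Real.sqrt (N ^ s * (S.total * S.renyi s)) := by
      calc ∑ x, traceNorm (S.V * S.badPart κ x * (S.U x).conjTranspose)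
          ≤ ∑ x, Real.sqrt (κ ^ (-s) * q x) * Real.sqrt (∑ a, S.lam x a) :=
            Finset.sum_le_sum fun x _ => S.traceNorm_badPart_le hκ hs x
        _ ≤ Real.sqrt (∑ x, κ ^ (-s) * q x) * Real.sqrt (∑ x, ∑ a, S.lam x a) :=
            Real.sum_sqrt_mul_sqrt_le _
              (fun x => mul_nonneg (Real.rpow_nonneg hκ.le _) (hqnn x))
              (fun x => Finset.sum_nonneg fun a _ => S.lam_nonneg x a)
        _ = Real.sqrt (N ^ s * (S.total * S.renyi s)) := by
            rw [← Finset.mul_sum, hqsum, ← Real.sqrt_mul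
              (mul_nonneg (Real.rpow_nonneg hκ.le _) hQ), hκdef, Real.inv_rpow hN.le,
              ← Real.rpow_neg hN.le, neg_neg, ← total]
            congr 1
            ring
    calc _ ≤ ∑ φ, ∑ u, ∑ x, |hashCoeff (g φ x) u| *
            traceNorm (S.V * S.badPart κ x * (S.U x).conjTranspose) := by
          refine Finset.sum_le_sum fun φ _ => Finset.sum_le_sum fun u _ => ?_
          refine (traceNorm_sum_le _ _).trans (Finset.sum_le_sum fun x _ => ?_)
          refine (traceNorm_smul_le _ _).trans (le_of_eq ?_)
          rw [Complex.norm_real, Real.norm_eq_abs]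
      _ = ∑ φ : Φ, ∑ x, (∑ u, |hashCoeff (g φ x) u|) *
            traceNorm (S.V * S.badPart κ x * (S.U x).conjTranspose) := by
          refine Finset.sum_congr rfl fun φ _ => ?_
          rw [Finset.sum_comm]
          simp_rw [Finset.sum_mul]
      _ ≤ ∑ φ : Φ, ∑ x, 2 *
            traceNorm (S.V * S.badPart κ x * (S.U x).conjTranspose) := by
          refine Finset.sum_le_sum fun φ _ => Finset.sum_le_sum fun x _ => ?_
          have := sum_abs_hashCoeff_le (g φ x)
          have := traceNorm_nonneg (S.V * S.badPart κ x * (S.U x).conjTranspose)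
          gcongr
      _ = F * (2 * ∑ x, traceNorm (S.V * S.badPart κ x * (S.U x).conjTranspose)) := by
          rw [← Finset.mul_sum, Finset.sum_const, Finset.card_univ, nsmul_eq_mul]
      _ ≤ _ := by gcongr
  calc _ ≤ ∑ φ, ∑ u, (traceNorm (P * (∑ x, (hashCoeff (g φ x) u : ℂ) • S.scaledGoodPart κ x)) +
        traceNorm (∑ x, (hashCoeff (g φ x) u : ℂ) •
          (S.V * S.badPart κ x * (S.U x).conjTranspose))) := by
        refine Finset.sum_le_sum fun φ _ => Finset.sum_le_sum fun u _ => ?_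
        rw [hsplit]
        exact traceNorm_add_le _ _
    _ ≤ F * (Real.sqrt 2 * Real.sqrt (N ^ s * (S.total * S.renyi s))) +
        F * (2 * Real.sqrt (N ^ s * (S.total * S.renyi s))) := by
        simp_rw [Finset.sum_add_distrib]
        exact add_le_add hgood hbad
    _ = _ := by ring

/-! ### Rényi quantities of order close to one -/

/-- In the exponential series, |sy|^k ≤ s²|y|^k for k ≥ 2 and 0 ≤ s ≤ 1; then e^|y| ≤ e^y + e^(-y).
With y = ln(λ/μ) the remainder consists of λ/μ and μ/λ, both of which have controlled averages. -/
lemma exp_mul_le_one_add {s : ℝ} (hs : 0 ≤ s) (hs1 : s ≤ 1) (y : ℝ) :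
    Real.exp (s * y) ≤ 1 + s * y + s ^ 2 * (Real.exp y + Real.exp (-y)) := by
  have hf : ∀ u : ℝ, HasSum (fun k : ℕ => u ^ k / k.factorial) (Real.exp u) := fun u => by
    have := NormedSpace.expSeries_div_hasSum_exp (𝔸 := ℝ) u
    rwa [← Real.exp_eq_exp_ℝ] at this
  have h2 : ∀ u : ℝ, HasSum (fun k : ℕ => u ^ (k + 2) / (k + 2).factorial)
      (Real.exp u - (1 + u)) := fun u => by
    have := (hasSum_nat_add_iff' 2).2 (hf u)
    simpa [Finset.sum_range_succ] using this
  have habs : Real.exp |y| ≤ Real.exp y + Real.exp (-y) := by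
    rcases abs_choice y with h | h <;> rw [h] <;> linarith [Real.exp_pos y, Real.exp_pos (-y)]
  have h3 : Real.exp (s * y) - (1 + s * y) ≤ s ^ 2 * (Real.exp |y| - (1 + |y|)) := by
    refine hasSum_le (fun k => ?_) (h2 (s * y)) ((h2 |y|).mul_left (s ^ 2))
    rw [← mul_div_assoc]
    gcongr
    calc (s * y) ^ (k + 2) ≤ |(s * y) ^ (k + 2)| := le_abs_self _
      _ = s ^ k * (s ^ 2 * |y| ^ (k + 2)) := by
          rw [abs_pow, abs_mul, abs_of_nonneg hs]; ring
      _ ≤ 1 * (s ^ 2 * |y| ^ (k + 2)) := by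
          gcongr
          exact pow_le_one₀ hs hs1
      _ = _ := one_mul _
  nlinarith [sq_nonneg s, abs_nonneg y, mul_nonneg (sq_nonneg s) (abs_nonneg y),
    mul_le_mul_of_nonneg_left habs (sq_nonneg s)]

namespace SpectralFamily

variable {X E : Type} [Fintype X] [Fintype E] [DecidableEq E] (S : SpectralFamily X E)

/-- The members are dominated by the sum: `Tr (ρ σ⁻¹ P) ≤ 1` for eigenprojections `P` of `ρ`. -/
lemma sum_weight_mul_ratio_le_one (x : X) (a : E) :
    ∑ b, S.weight x b a * (S.lam x a / S.mu b) ≤ 1 := by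
  set c : ℝ := ∑ b, S.weight x b a * (S.mu b)⁻¹ with hc
  -- With |a⟩ the a-th eigenvector of ρ_x, v is σ⁻¹|a⟩ in the eigenbasis of σ, and c = ⟨a|σ⁻¹|a⟩.
  -- Then ⟨v|σ|v⟩ = c, while the single term λ|⟨a|v⟩|² of this form equals λc². Hence λc² ≤ c, so λc
  -- ≤ 1.
  set v : E → ℂ := fun b => S.overlap x b a * ((S.mu b)⁻¹ : ℝ) with hv
  have hc0 : 0 ≤ c := Finset.sum_nonneg fun b _ =>
    mul_nonneg (S.weight_nonneg x b a) (inv_nonneg.2 (S.mu_nonneg b))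
  have hquad : ∑ x', ∑ a', S.lam x' a' * ‖∑ b, star (S.overlap x' b a') * v b‖ ^ 2 = c := by
    have : ((∑ x', ∑ a', S.lam x' a' * ‖∑ b, star (S.overlap x' b a') * v b‖ ^ 2 : ℝ) : ℂ) =
        (c : ℝ) := by
      calc ((∑ x', ∑ a', S.lam x' a' * ‖∑ b, star (S.overlap x' b a') * v b‖ ^ 2 : ℝ) : ℂ)
          = ∑ x', ∑ a', ∑ b, ∑ b', v b * star (v b') *
              (S.overlap x' b' a' * S.lam x' a' * star (S.overlap x' b a')) := by
            push_cast
            refine Finset.sum_congr rfl fun x' _ => Finset.sum_congr rfl fun a' _ => ?_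
            rw [← Complex.mul_conj', map_sum, Finset.sum_mul_sum, Finset.mul_sum]
            refine Finset.sum_congr rfl fun b _ => ?_
            rw [Finset.mul_sum]
            refine Finset.sum_congr rfl fun b' _ => ?_
            simp only [RCLike.star_def, map_mul, Complex.conj_conj]
            ring
        _ = ∑ b, ∑ b', v b * star (v b') * if b' = b then (S.mu b' : ℂ) else 0 := by
            simp_rw [← S.sum_overlap_apply, Finset.mul_sum]
            rw [Finset.sum_congr rfl fun x' _ => Finset.sum_comm, Finset.sum_comm]
            refine Finset.sum_congr rfl fun b _ => ?_
            rw [Finset.sum_congr rfl fun x' _ => Finset.sum_comm, Finset.sum_comm]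
        _ = (c : ℝ) := by
            rw [hc]
            push_cast
            refine Finset.sum_congr rfl fun b _ => ?_
            simp only [mul_ite, mul_zero, Finset.sum_ite_eq', Finset.mem_univ, if_true]
            rw [hv]
            simp only [RCLike.star_def, map_mul, Complex.conj_ofReal, weight]
            push_cast
            rw [← Complex.mul_conj']
            by_cases h0 : S.mu b = 0
            · simp [h0]
            · have : (S.mu b : ℂ) ≠ 0 := by exact_mod_cast h0
              field_simp
    exact_mod_cast this
  have hinner : ∑ b, star (S.overlap x b a) * v b = (c : ℂ) := by
    rw [hc]
    push_cast
    refine Finset.sum_congr rfl fun b _ => ?_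
    rw [hv, weight]
    push_cast
    rw [← Complex.mul_conj']
    simp only [RCLike.star_def]
    ring
  have hterm : S.lam x a * c ^ 2 ≤ c := by
    have hnn : ∀ x' a', 0 ≤ S.lam x' a' * ‖∑ b, star (S.overlap x' b a') * v b‖ ^ 2 :=
      fun x' a' => mul_nonneg (S.lam_nonneg x' a') (by positivity)
    have h1 := Finset.single_le_sum
      (f := fun a' => S.lam x a' * ‖∑ b, star (S.overlap x b a') * v b‖ ^ 2)
      (fun a' _ => hnn x a') (Finset.mem_univ a)
    have h2 := Finset.single_le_sum
      (f := fun x' => ∑ a', S.lam x' a' * ‖∑ b, star (S.overlap x' b a') * v b‖ ^ 2)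
      (fun x' _ => Finset.sum_nonneg fun a' _ => hnn x' a') (Finset.mem_univ x)
    have h3 := h1.trans h2
    simp only [hinner] at h3
    rw [hquad, Complex.norm_real, Real.norm_eq_abs, sq_abs] at h3
    exact h3
  have hgoal : ∑ b, S.weight x b a * (S.lam x a / S.mu b) = S.lam x a * c := by
    rw [hc, Finset.mul_sum]
    refine Finset.sum_congr rfl fun b _ => ?_
    rw [div_eq_mul_inv]; ring
  rw [hgoal]
  rcases hc0.eq_or_lt with h0 | h0
  · simp [← h0]
  · have : S.lam x a * c * c ≤ 1 * c := by nlinarith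
    exact le_of_mul_le_mul_right this h0

/-- The negative of the conditional entropy `H(X|E)` of the family, in nats. -/
def negEntropy : ℝ :=
  ∑ x, ∑ a, S.lam x a * Real.log (S.lam x a) - ∑ b, S.mu b * Real.log (S.mu b)

lemma negEntropy_eq : S.negEntropy =
    ∑ x, ∑ b, ∑ a, S.weight x b a * S.lam x a * Real.log (S.lam x a / S.mu b) := by
  have h1 : ∑ x, ∑ a, S.lam x a * Real.log (S.lam x a) =
      ∑ x, ∑ b, ∑ a, S.weight x b a * S.lam x a * Real.log (S.lam x a) := by
    refine Finset.sum_congr rfl fun x _ => ?_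
    rw [Finset.sum_comm]
    refine Finset.sum_congr rfl fun a _ => ?_
    simp_rw [mul_assoc]
    rw [← Finset.sum_mul, S.sum_weight_left, one_mul]
  have h2 : ∑ b, S.mu b * Real.log (S.mu b) =
      ∑ x, ∑ b, ∑ a, S.weight x b a * S.lam x a * Real.log (S.mu b) := by
    rw [Finset.sum_comm]
    refine Finset.sum_congr rfl fun b _ => ?_
    simp_rw [← Finset.sum_mul]
    rw [S.sum_weight_mul_lam]
  rw [negEntropy, h1, h2]
  simp_rw [← Finset.sum_sub_distrib]
  refine Finset.sum_congr rfl fun x _ => Finset.sum_congr rfl fun b _ =>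
    Finset.sum_congr rfl fun a _ => ?_
  by_cases hm : S.mu b = 0
  · simp [S.weight_mul_lam_eq_zero x a hm]
  by_cases hl : S.lam x a = 0
  · simp [hl]
  rw [Real.log_div hl hm]
  ring

/-- Second-order expansion at s = 0, averaged with weight · λ. In the remainder, λ/μ averages to at
most `total` by `sum_weight_mul_ratio_le_one`, and μ/λ to at most |X| · `total` because the weights
are doubly stochastic. -/
lemma renyi_le {s : ℝ} (hs : 0 ≤ s) (hs1 : s ≤ 1) :
    S.renyi s ≤ S.total + s * S.negEntropy + s ^ 2 * ((1 + Fintype.card X) * S.total) := by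
  have hterm : ∀ x b a, S.weight x b a * S.lam x a * (S.lam x a / S.mu b) ^ s ≤
      S.weight x b a * S.lam x a
      + s * (S.weight x b a * S.lam x a * Real.log (S.lam x a / S.mu b))
      + s ^ 2 * (S.lam x a * (S.weight x b a * (S.lam x a / S.mu b)) +
          S.weight x b a * S.mu b) := by
    intro x b a
    have hw := S.weight_nonneg x b a
    have hl0 := S.lam_nonneg x a
    have hm0 := S.mu_nonneg b
    have hrest : 0 ≤ s ^ 2 * (S.lam x a * (S.weight x b a * (S.lam x a / S.mu b)) +
          S.weight x b a * S.mu b) := by positivity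
    by_cases hm : S.mu b = 0
    · rw [S.weight_mul_lam_eq_zero x a hm]
      simpa using hrest
    by_cases hl : S.lam x a = 0
    · rw [hl] at hrest ⊢
      simpa using hrest
    have hl' := hl0.lt_of_ne' hl
    have hm' := hm0.lt_of_ne' hm
    have hr : 0 < S.lam x a / S.mu b := div_pos hl' hm'
    have h1 := exp_mul_le_one_add hs hs1 (Real.log (S.lam x a / S.mu b))
    rw [Real.exp_log hr, Real.exp_neg, Real.exp_log hr, mul_comm s, ← Real.rpow_def_of_pos hr,
      inv_div] at h1
    have h2 := mul_le_mul_of_nonneg_left h1 (mul_nonneg hw hl0)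
    refine h2.trans (le_of_eq ?_)
    field_simp
  have hA : ∑ x, ∑ b, ∑ a, S.weight x b a * S.lam x a = S.total := by
    rw [Finset.sum_comm, ← S.sum_mu]
    simp_rw [S.sum_weight_mul_lam]
  have hB : ∑ x, ∑ b, ∑ a, S.lam x a * (S.weight x b a * (S.lam x a / S.mu b)) ≤ S.total := by
    refine Finset.sum_le_sum fun x _ => ?_
    rw [Finset.sum_comm]
    refine Finset.sum_le_sum fun a _ => ?_
    rw [← Finset.mul_sum]
    exact mul_le_of_le_one_right (S.lam_nonneg x a) (S.sum_weight_mul_ratio_le_one x a)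
  have hC : ∑ x, ∑ b, ∑ a, S.weight x b a * S.mu b = Fintype.card X * S.total := by
    simp_rw [← Finset.sum_mul, S.sum_weight_right, one_mul, S.sum_mu]
    simp
  calc S.renyi s ≤ ∑ x, ∑ b, ∑ a, (S.weight x b a * S.lam x a
      + s * (S.weight x b a * S.lam x a * Real.log (S.lam x a / S.mu b))
      + s ^ 2 * (S.lam x a * (S.weight x b a * (S.lam x a / S.mu b)) +
          S.weight x b a * S.mu b)) := Finset.sum_le_sum fun x _ => Finset.sum_le_sum fun b _ =>
        Finset.sum_le_sum fun a _ => hterm x b a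
    _ = S.total + s * S.negEntropy +
        s ^ 2 * (∑ x, ∑ b, ∑ a, S.lam x a * (S.weight x b a * (S.lam x a / S.mu b)) +
          Fintype.card X * S.total) := by
        rw [S.negEntropy_eq, ← hC]
        simp_rw [Finset.sum_add_distrib, ← Finset.mul_sum, Finset.sum_add_distrib]
        rw [hA]
    _ ≤ _ := by
        have := mul_le_mul_of_nonneg_left hB (sq_nonneg s)
        linarith

end SpectralFamily

/-! ### Entropies and spectral data of states -/

section Entropy

variable {a c X : Type} [Fintype c] [Fintype X] [DecidableEq c]

lemma cqState_conjTranspose (f : c → Matrix a a ℂ) :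
    (cqState f).conjTranspose = cqState fun x => (f x).conjTranspose := by
  ext ⟨x, i⟩ ⟨y, j⟩
  rw [Matrix.conjTranspose_apply, cqState_apply, cqState_apply]
  by_cases h : x = y
  · subst h; simp
  · simp [h, Ne.symm h]

lemma sum_cqState (f : X → c → Matrix a a ℂ) :
    ∑ x, cqState (f x) = cqState fun y => ∑ x, f x y := by
  ext p q
  rw [Matrix.sum_apply]
  simp_rw [cqState_apply]
  by_cases h : p.1 = q.1
  · simp [h, Matrix.sum_apply]
  · simp [h]

lemma partialTraceFst_cqState (f : c → Matrix a a ℂ) :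
    partialTraceFst (cqState f) = ∑ x, f x := by
  ext i j
  rw [partialTraceFst, Matrix.of_apply, Matrix.sum_apply]
  simp [cqState_apply]

lemma isHermitian_cqState {f : c → Matrix a a ℂ} (h : ∀ x, (f x).IsHermitian) :
    (cqState f).IsHermitian := by
  rw [Matrix.IsHermitian, cqState_conjTranspose]
  congr 1
  funext x
  exact h x

variable [DecidableEq a]

lemma cqState_diagonal (f : c → a → ℂ) :
    (cqState fun x => Matrix.diagonal (f x)) = Matrix.diagonal fun p => f p.1 p.2 := by
  ext ⟨x, i⟩ ⟨y, j⟩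
  rw [cqState_apply, Matrix.diagonal_apply, Matrix.diagonal_apply]
  by_cases h : x = y
  · subst h; simp
  · simp [h]

lemma cqState_one : (cqState fun _ : c => (1 : Matrix a a ℂ)) = 1 := by
  simp_rw [← Matrix.diagonal_one]
  exact cqState_diagonal fun _ _ => 1

variable [Fintype a]

lemma posSemidef_mul_diagonal_mul {b : Type} [Fintype b] (U : Matrix b a ℂ) {lam : a → ℝ}
    (h : ∀ i, 0 ≤ lam i) :
    (U * Matrix.diagonal (fun i => (lam i : ℂ)) * U.conjTranspose).PosSemidef :=
  (Matrix.posSemidef_diagonal_iff.2 fun i => by exact_mod_cast h i).mul_mul_conjTranspose_same U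

lemma eigenvectorUnitary_mul_diagonal {A : Matrix a a ℂ} (h : A.IsHermitian) :
    h.eigenvectorUnitary.1 * Matrix.diagonal (fun i => (h.eigenvalues i : ℂ)) *
      h.eigenvectorUnitary.1.conjTranspose = A := by
  have := h.spectral_theorem
  rw [Unitary.conjStarAlgAut_apply] at this
  exact this.symm

lemma conjTranspose_mul_eigenvectorUnitary {A : Matrix a a ℂ} (h : A.IsHermitian) :
    h.eigenvectorUnitary.1.conjTranspose * h.eigenvectorUnitary.1 = 1 :=
  Unitary.coe_star_mul_self h.eigenvectorUnitary

lemma isHermitian_mul_diagonal_mul (U : Matrix a a ℂ) (lam : a → ℝ) :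
    (U * Matrix.diagonal (fun i => (lam i : ℂ)) * U.conjTranspose).IsHermitian := by
  apply Matrix.isHermitian_mul_mul_conjTranspose
  rw [Matrix.IsHermitian, Matrix.diagonal_conjTranspose]
  congr 1
  funext i
  simp

/-- The von Neumann entropy computed from any diagonalization. -/
lemma vonNeumannEntropy_mul_diagonal_mul {U : Matrix a a ℂ} (hU : U.conjTranspose * U = 1)
    (lam : a → ℝ) :
    vonNeumannEntropy (U * Matrix.diagonal (fun i => (lam i : ℂ)) * U.conjTranspose) =
      -∑ i, lam i * Real.logb 2 (lam i) := by
  set A := U * Matrix.diagonal (fun i => (lam i : ℂ)) * U.conjTranspose with hA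
  have h : A.IsHermitian := isHermitian_mul_diagonal_mul U lam
  have h1 := h.roots_charpoly_eq_eigenvalues
  -- The chosen eigenvalues and `lam` may be ordered differently; as multisets both are the roots of
  -- the characteristic polynomial.
  have h2 : A.charpoly.roots = Multiset.map (fun i => (lam i : ℂ)) Finset.univ.val := by
    rw [hA, Matrix.charpoly_mul_comm, ← Matrix.mul_assoc, hU, Matrix.one_mul,
      Matrix.charpoly_diagonal, Polynomial.roots_prod]
    · simp
    · simp [Finset.prod_ne_zero_iff, Polynomial.X_sub_C_ne_zero]
  have h3 := congrArg (Multiset.map fun z : ℂ => z.re * Real.logb 2 z.re) (h1.symm.trans h2)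
  rw [Multiset.map_map, Multiset.map_map] at h3
  have h4 := congrArg Multiset.sum h3
  rw [vonNeumannEntropy, dif_pos h]
  congr 1

lemma cqState_eq_mul_diagonal_mul {f : c → Matrix a a ℂ} (h : ∀ x, (f x).IsHermitian) :
    cqState f = cqState (fun x => (h x).eigenvectorUnitary.1) *
      Matrix.diagonal (fun p : c × a => ((h p.1).eigenvalues p.2 : ℂ)) *
      (cqState fun x => (h x).eigenvectorUnitary.1).conjTranspose := by
  rw [← cqState_diagonal fun x i => ((h x).eigenvalues i : ℂ), cqState_conjTranspose, cqState_mul,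
    cqState_mul]
  congr 1
  funext x
  exact (eigenvectorUnitary_mul_diagonal (h x)).symm

lemma vonNeumannEntropy_cqState {f : c → Matrix a a ℂ} (h : ∀ x, (f x).IsHermitian) :
    vonNeumannEntropy (cqState f) = ∑ x, vonNeumannEntropy (f x) := by
  have e2 : (cqState fun x => (h x).eigenvectorUnitary.1).conjTranspose *
      (cqState fun x => (h x).eigenvectorUnitary.1) = 1 := by
    rw [cqState_conjTranspose, cqState_mul]
    simp_rw [conjTranspose_mul_eigenvectorUnitary]
    exact cqState_one
  rw [cqState_eq_mul_diagonal_mul h,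
    vonNeumannEntropy_mul_diagonal_mul e2 fun p : c × a => (h p.1).eigenvalues p.2,
    Fintype.sum_prod_type, ← Finset.sum_neg_distrib]
  refine Finset.sum_congr rfl fun x _ => ?_
  rw [vonNeumannEntropy, dif_pos (h x)]

lemma posSemidef_cqState {f : c → Matrix a a ℂ} (h : ∀ x, (f x).PosSemidef) :
    (cqState f).PosSemidef := by
  rw [cqState_eq_mul_diagonal_mul fun x => (h x).1]
  exact posSemidef_mul_diagonal_mul _ fun p => (h p.1).eigenvalues_nonneg p.2

/-- The spectral data of a family of positive operators. -/
def SpectralFamily.ofPosSemidef {ρ : X → Matrix a a ℂ} (h : ∀ x, (ρ x).PosSemidef) :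
    SpectralFamily X a where
  U x := (h x).1.eigenvectorUnitary.1
  V := (Matrix.posSemidef_sum Finset.univ fun x _ => h x).1.eigenvectorUnitary.1
  lam x := (h x).1.eigenvalues
  mu := (Matrix.posSemidef_sum Finset.univ fun x _ => h x).1.eigenvalues
  star_mul_U x := conjTranspose_mul_eigenvectorUnitary _
  star_mul_V := conjTranspose_mul_eigenvectorUnitary _
  lam_nonneg x := (h x).eigenvalues_nonneg
  sum_eq := by
    rw [eigenvectorUnitary_mul_diagonal]
    exact Finset.sum_congr rfl fun x _ => eigenvectorUnitary_mul_diagonal _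

lemma SpectralFamily.op_ofPosSemidef {ρ : X → Matrix a a ℂ} (h : ∀ x, (ρ x).PosSemidef) (x : X) :
    (ofPosSemidef h).op x = ρ x := eigenvectorUnitary_mul_diagonal _

lemma SpectralFamily.negEntropy_ofPosSemidef {ρ : X → Matrix a a ℂ} (h : ∀ x, (ρ x).PosSemidef) :
    (ofPosSemidef h).negEntropy =
      -Real.log 2 * (∑ x, vonNeumannEntropy (ρ x) - vonNeumannEntropy (∑ x, ρ x)) := by
  have hl : Real.log 2 ≠ 0 := (Real.log_pos (by norm_num)).ne'
  have e : ∀ {A : Matrix a a ℂ} (hA : A.IsHermitian),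
      ∑ i, hA.eigenvalues i * Real.log (hA.eigenvalues i) =
        -Real.log 2 * vonNeumannEntropy A := by
    intro A hA
    rw [vonNeumannEntropy, dif_pos hA, neg_mul_neg, Finset.mul_sum]
    refine Finset.sum_congr rfl fun i _ => ?_
    rw [Real.logb]
    field_simp
  rw [negEntropy, mul_sub, Finset.mul_sum]
  congr 1
  · exact Finset.sum_congr rfl fun x _ => e (h x).1
  · exact e (Matrix.posSemidef_sum Finset.univ fun x _ => h x).1

lemma SpectralFamily.total_ofPosSemidef {ρ : X → Matrix a a ℂ} (h : ∀ x, (ρ x).PosSemidef) :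
    (((ofPosSemidef h).total : ℝ) : ℂ) = ∑ x, (ρ x).trace := by
  rw [total]
  push_cast
  refine Finset.sum_congr rfl fun x _ => ?_
  rw [(h x).1.trace_eq_sum_eigenvalues]
  rfl

end Entropy

/-! ### A single round of the protocol -/

lemma posSemidef_sum_kraus {a b ι : Type} [Fintype a] [Fintype b] [Fintype ι]
    (K : ι → Matrix b a ℂ) {ρ : Matrix a a ℂ} (h : ρ.PosSemidef) :
    (∑ j, K j * ρ * (K j).conjTranspose).PosSemidef :=
  Matrix.posSemidef_sum _ fun j _ => h.mul_mul_conjTranspose_same (K j)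

lemma posSemidef_bb84 (x : Fin 2) (θ : Basis) : (bb84 x θ).PosSemidef :=
  Matrix.posSemidef_vecMulVec_self_star _

lemma trace_bb84 (x : Fin 2) (θ : Basis) : (bb84 x θ).trace = 1 := by
  have h2 : ((Real.sqrt 2 : ℝ) : ℂ) * ((Real.sqrt 2 : ℝ) : ℂ) = 2 := by
    rw [← Complex.ofReal_mul, Real.mul_self_sqrt (by norm_num)]; norm_num
  have h3 : ((Real.sqrt 2 : ℝ) : ℂ)⁻¹ * ((Real.sqrt 2 : ℝ) : ℂ)⁻¹ = 1 / 2 := by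
    rw [← mul_inv, h2]; norm_num
  rw [bb84, Matrix.trace_vecMulVec]
  fin_cases x <;> cases θ <;>
    simp [bb84Ket, dotProduct, Fin.sum_univ_two, neg_div, h3] <;> norm_num

lemma trace_sum_kraus {a b ι : Type} [Fintype a] [DecidableEq a] [Fintype b] [Fintype ι]
    {K : ι → Matrix b a ℂ} (hK : ∑ j, (K j).conjTranspose * K j = 1) (ρ : Matrix a a ℂ) :
    (∑ j, K j * ρ * (K j).conjTranspose).trace = ρ.trace := by
  rw [Matrix.trace_sum]
  have : ∀ j, (K j * ρ * (K j).conjTranspose).trace = ((K j).conjTranspose * K j * ρ).trace :=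
    fun j => by rw [Matrix.trace_mul_comm, Matrix.mul_assoc]
  simp_rw [this]
  rw [← Matrix.trace_sum, ← Matrix.sum_mul, hK, Matrix.one_mul]

namespace IndividualStorageAttack

variable {n ℓ : ℕ} {𝓕 : Finset (BitString n → BitString ℓ)} (A : IndividualStorageAttack 𝓕)

lemma posSemidef_roundOp (i : Fin n) (x : Fin 2) (θ : Basis) (k : Fin (A.outcomes i)) :
    (A.roundOp i x θ k).PosSemidef := by
  refine Matrix.PosSemidef.smul ?_ (by norm_num [Complex.le_def])
  exact posSemidef_sum_kraus _ (posSemidef_sum_kraus _ (posSemidef_bb84 x θ))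

/-- The spectral data of the stored system of the round `i` for given basis and outcome. -/
def roundFamily (i : Fin n) (θ : Basis) (k : Fin (A.outcomes i)) :
    SpectralFamily (Fin 2) (Fin (A.storeDim i)) :=
  SpectralFamily.ofPosSemidef fun x => A.posSemidef_roundOp i x θ k

lemma sum_trace_roundOp (i : Fin n) (x : Fin 2) (θ : Basis) :
    ∑ k, (A.roundOp i x θ k).trace = 1 / 4 := by
  have h1 : ∀ k, (A.roundOp i x θ k).trace =
      1 / 4 * ((A.measure i).apply k (bb84 x θ)).trace := by
    intro k
    rw [roundOp, Matrix.trace_smul, smul_eq_mul, Channel.apply,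
      trace_sum_kraus (A.noise i).complete]
  simp_rw [h1]
  rw [← Finset.mul_sum, ← Matrix.trace_sum]
  have h2 := trace_sum_kraus (ι := Fin (A.outcomes i) × Fin (A.measure i).num)
    (K := fun p => (A.measure i).kraus p.1 p.2)
    (by rw [Fintype.sum_prod_type]; exact (A.measure i).complete) (bb84 x θ)
  rw [Fintype.sum_prod_type, trace_bb84] at h2
  unfold Measurement.apply
  rw [h2, mul_one]

lemma sum_total_roundFamily (i : Fin n) : ∑ θ, ∑ k, (A.roundFamily i θ k).total = 1 := by
  have : ((∑ θ, ∑ k, (A.roundFamily i θ k).total : ℝ) : ℂ) = 1 := by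
    push_cast
    unfold roundFamily
    simp_rw [SpectralFamily.total_ofPosSemidef]
    rw [Finset.sum_congr rfl fun θ _ => Finset.sum_comm]
    simp_rw [sum_trace_roundOp]
    simp only [Finset.sum_const, Finset.card_univ, Fintype.card_fin]
    rw [show Fintype.card Basis = 2 from rfl]
    norm_num
  exact_mod_cast this

/-- Entropy is additive over the unnormalized blocks indexed by θ and k, so conditioning on these
classical registers is a plain sum. -/
lemma sum_negEntropy_roundFamily (i : Fin n) :
    ∑ θ, ∑ k, (A.roundFamily i θ k).negEntropy = -Real.log 2 * condEntropy (A.roundState i) := by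
  have hh : ∀ x θ k, (A.roundOp i x θ k).IsHermitian := fun x θ k =>
    (A.posSemidef_roundOp i x θ k).1
  have hs : ∀ θ k, (∑ x, A.roundOp i x θ k).IsHermitian := fun θ k =>
    (Matrix.posSemidef_sum _ fun x _ => A.posSemidef_roundOp i x θ k).1
  rw [condEntropy, roundState, partialTraceFst_cqState, sum_cqState]
  simp_rw [sum_cqState]
  rw [vonNeumannEntropy_cqState fun x => isHermitian_cqState fun θ => isHermitian_cqState fun k =>
      hh x θ k, vonNeumannEntropy_cqState fun θ => isHermitian_cqState fun k => hs θ k]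
  simp_rw [fun x => vonNeumannEntropy_cqState fun θ => isHermitian_cqState fun k => hh x θ k,
    fun x θ => vonNeumannEntropy_cqState fun k => hh x θ k,
    fun θ => vonNeumannEntropy_cqState fun k => hs θ k]
  unfold roundFamily
  simp_rw [SpectralFamily.negEntropy_ofPosSemidef, ← Finset.mul_sum, Finset.sum_sub_distrib]
  congr 2
  rw [Finset.sum_congr rfl fun θ _ => Finset.sum_comm, Finset.sum_comm]

/-- The Rényi quantity of a round is bounded in terms of the von Neumann entropy. -/
lemma sum_renyi_roundFamily_le {t : ℝ} (ht : A.IsUncertaintyLowerBound t) {s : ℝ} (hs : 0 ≤ s)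
    (hs1 : s ≤ 1) (i : Fin n) :
    ∑ θ, ∑ k, (A.roundFamily i θ k).renyi s ≤ Real.exp (3 * s ^ 2 - s * t * Real.log 2) := by
  calc ∑ θ, ∑ k, (A.roundFamily i θ k).renyi s
      ≤ ∑ θ, ∑ k, ((A.roundFamily i θ k).total + s * (A.roundFamily i θ k).negEntropy +
          s ^ 2 * (3 * (A.roundFamily i θ k).total)) := by
        refine Finset.sum_le_sum fun θ _ => Finset.sum_le_sum fun k _ => ?_
        have := (A.roundFamily i θ k).renyi_le hs hs1
        rw [Fintype.card_fin] at this
        refine this.trans (le_of_eq ?_)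
        push_cast
        ring
    -- Here 3 = 1 + |{0,1}|. Passing from 1 + x to e^x afterwards makes the bound convenient for
    -- products over rounds.
    _ = (3 * s ^ 2 - s * condEntropy (A.roundState i) * Real.log 2) + 1 := by
        simp_rw [Finset.sum_add_distrib, ← Finset.mul_sum]
        rw [sum_total_roundFamily, sum_negEntropy_roundFamily]
        ring
    _ ≤ (3 * s ^ 2 - s * t * Real.log 2) + 1 := by
        have := ht i
        have hl := Real.log_pos (one_lt_two)
        gcongr
    _ ≤ _ := Real.add_one_le_exp _

end IndividualStorageAttack

/-! ### Tensor products of families -/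

section Tensor

variable {n : ℕ} {d : Fin n → ℕ}

lemma tensorFamily_mul (M N : ∀ i, Matrix (Fin (d i)) (Fin (d i)) ℂ) :
    tensorFamily M * tensorFamily N = tensorFamily fun i => M i * N i := by
  ext p q
  simp only [tensorFamily, Matrix.mul_apply, Matrix.of_apply]
  rw [Finset.prod_univ_sum, Fintype.piFinset_univ]
  simp_rw [Finset.prod_mul_distrib]

lemma tensorFamily_conjTranspose (M : ∀ i, Matrix (Fin (d i)) (Fin (d i)) ℂ) :
    (tensorFamily M).conjTranspose = tensorFamily fun i => (M i).conjTranspose := by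
  ext p q
  simp [tensorFamily, Matrix.conjTranspose_apply]

lemma tensorFamily_diagonal (f : ∀ i, Fin (d i) → ℂ) :
    (tensorFamily fun i => Matrix.diagonal (f i)) =
      Matrix.diagonal fun p => ∏ i, f i (p i) := by
  ext p q
  rw [tensorFamily, Matrix.of_apply, Matrix.diagonal_apply]
  split_ifs with h
  · subst h; simp
  · obtain ⟨i, hi⟩ := Function.ne_iff.1 h
    exact Finset.prod_eq_zero (Finset.mem_univ i) (Matrix.diagonal_apply_ne _ hi)

lemma tensorFamily_one :
    (tensorFamily fun i => (1 : Matrix (Fin (d i)) (Fin (d i)) ℂ)) = 1 := by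
  simp_rw [← Matrix.diagonal_one]
  rw [tensorFamily_diagonal]
  simp

variable {I : Fin n → Type} [∀ i, Fintype (I i)]

lemma sum_tensorFamily (M : ∀ i, I i → Matrix (Fin (d i)) (Fin (d i)) ℂ) :
    ∑ x : ∀ i, I i, tensorFamily (fun i => M i (x i)) = tensorFamily fun i => ∑ z, M i z := by
  ext p q
  simp only [tensorFamily, Matrix.sum_apply, Matrix.of_apply]
  rw [Finset.prod_univ_sum, Fintype.piFinset_univ]

/-- The spectral data of a tensor product of families. -/
def SpectralFamily.tensor (S : ∀ i, SpectralFamily (I i) (Fin (d i))) :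
    SpectralFamily (∀ i, I i) (∀ i, Fin (d i)) where
  U x := tensorFamily fun i => (S i).U (x i)
  V := tensorFamily fun i => (S i).V
  lam x a := ∏ i, (S i).lam (x i) (a i)
  mu b := ∏ i, (S i).mu (b i)
  star_mul_U x := by
    rw [tensorFamily_conjTranspose, tensorFamily_mul]
    simp only [SpectralFamily.star_mul_U]
    exact tensorFamily_one
  star_mul_V := by
    rw [tensorFamily_conjTranspose, tensorFamily_mul]
    simp only [SpectralFamily.star_mul_V]
    exact tensorFamily_one
  lam_nonneg x a := Finset.prod_nonneg fun i _ => (S i).lam_nonneg (x i) (a i)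
  sum_eq := by
    push_cast
    simp only [fun x : ∀ i, I i => (tensorFamily_diagonal fun i a => ((S i).lam (x i) a : ℂ)).symm,
      (tensorFamily_diagonal fun i b => ((S i).mu b : ℂ)).symm, tensorFamily_conjTranspose,
      tensorFamily_mul]
    rw [sum_tensorFamily fun i z => (S i).U z *
      Matrix.diagonal (fun a => ((S i).lam z a : ℂ)) * ((S i).U z).conjTranspose]
    congr 1
    funext i
    exact (S i).sum_eq

namespace SpectralFamily

variable (S : ∀ i, SpectralFamily (I i) (Fin (d i)))

lemma op_tensor (x : ∀ i, I i) : (tensor S).op x = tensorFamily fun i => (S i).op (x i) := by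
  simp only [op, tensor]
  push_cast
  rw [← tensorFamily_diagonal (fun i a => ((S i).lam (x i) a : ℂ)), tensorFamily_conjTranspose,
    tensorFamily_mul, tensorFamily_mul]

lemma total_tensor : (tensor S).total = ∏ i, (S i).total := by
  simp only [total, tensor]
  rw [Finset.prod_univ_sum, Fintype.piFinset_univ]
  refine Finset.sum_congr rfl fun x _ => ?_
  rw [Finset.prod_univ_sum, Fintype.piFinset_univ]

lemma weight_tensor (x : ∀ i, I i) (b a : ∀ i, Fin (d i)) :
    (tensor S).weight x b a = ∏ i, (S i).weight (x i) (b i) (a i) := by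
  simp only [weight, overlap, tensor]
  rw [tensorFamily_conjTranspose, tensorFamily_mul, tensorFamily, Matrix.of_apply, norm_prod,
    Finset.prod_pow]

/-- Exact multiplicativity is the reason for working with this quantity: single-round bounds carry
over to n rounds without loss. -/
lemma renyi_tensor (s : ℝ) : (tensor S).renyi s = ∏ i, (S i).renyi s := by
  simp only [renyi]
  rw [Finset.prod_univ_sum, Fintype.piFinset_univ]
  refine Finset.sum_congr rfl fun x _ => ?_
  rw [Finset.prod_univ_sum, Fintype.piFinset_univ]
  refine Finset.sum_congr rfl fun b _ => ?_
  rw [Finset.prod_univ_sum, Fintype.piFinset_univ]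
  refine Finset.sum_congr rfl fun a _ => ?_
  rw [weight_tensor, Finset.prod_mul_distrib, Finset.prod_mul_distrib,
    Real.finsetProd_rpow _ _ fun i _ => div_nonneg ((S i).lam_nonneg _ _) ((S i).mu_nonneg _),
    Finset.prod_div_distrib]
  rfl

end SpectralFamily

end Tensor

/-! ### Subfamilies: rounds whose bit is fixed. -/

namespace SpectralFamily

variable {X E : Type} [Fintype X] [Fintype E] [DecidableEq E]
  (S : SpectralFamily X E)

/-- The subfamily that consists of a single member. -/
def single (y : X) : SpectralFamily {z // z = y} E where
  U z := S.U z
  V := S.U y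
  lam z := S.lam z
  mu := S.lam y
  star_mul_U z := S.star_mul_U z
  star_mul_V := S.star_mul_U y
  lam_nonneg z := S.lam_nonneg z
  sum_eq := by rw [Fintype.sum_unique]; rfl

lemma total_single (y : X) : (S.single y).total = ∑ a, S.lam y a := by
  rw [total, Fintype.sum_unique]
  rfl

/-- A single member is its own sum, so the eigenbases agree and all relevant ratios are 1. A round
with fixed bit therefore contributes its trace, whatever s is. -/
lemma renyi_single (y : X) (s : ℝ) : (S.single y).renyi s = ∑ a, S.lam y a := by
  have hw : ∀ b a, (S.single y).weight ⟨y, rfl⟩ b a = if b = a then 1 else 0 := by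
    intro b a
    simp only [weight, overlap, single]
    rw [S.star_mul_U, Matrix.one_apply]
    split_ifs <;> simp
  simp only [renyi, Fintype.sum_unique]
  change ∑ b, ∑ a, (S.single y).weight ⟨y, rfl⟩ b a * S.lam y a * (S.lam y a / S.lam y b) ^ s = _
  refine Finset.sum_congr rfl fun b _ => ?_
  simp_rw [hw]
  rw [Finset.sum_eq_single b]
  · by_cases h : S.lam y b = 0
    · simp [h]
    · simp [div_self h]
  · intro a _ ha
    simp [Ne.symm ha]
  · simp

/-- Change of the index type. -/
def reindex {X' : Type} [Fintype X'] (e : X' ≃ X) : SpectralFamily X' E where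
  U z := S.U (e z)
  V := S.V
  lam z := S.lam (e z)
  mu := S.mu
  star_mul_U z := S.star_mul_U _
  star_mul_V := S.star_mul_V
  lam_nonneg z := S.lam_nonneg _
  sum_eq := by
    rw [← S.sum_eq]
    exact e.sum_comp fun x => S.U x * Matrix.diagonal (fun a => (S.lam x a : ℂ)) *
      (S.U x).conjTranspose

lemma total_reindex {X' : Type} [Fintype X'] (e : X' ≃ X) : (S.reindex e).total = S.total :=
  e.sum_comp fun x => ∑ a, S.lam x a

lemma renyi_reindex {X' : Type} [Fintype X'] (e : X' ≃ X) (s : ℝ) :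
    (S.reindex e).renyi s = S.renyi s :=
  e.sum_comp fun x => ∑ b, ∑ a, S.weight x b a * S.lam x a * (S.lam x a / S.mu b) ^ s

variable [DecidableEq X]

/-- The whole family if `P` holds, the subfamily of the member `y` otherwise. -/
def restrict (P : Prop) [Decidable P] (y : X) : SpectralFamily {z // P ∨ z = y} E :=
  if h : P then S.reindex (Equiv.subtypeUnivEquiv fun _ => Or.inl h)
  else (S.single y).reindex (Equiv.subtypeEquivRight fun _ => by simp [h])

lemma op_restrict (P : Prop) [Decidable P] (y : X) (z : {z // P ∨ z = y}) : (S.restrict P y).op z = S.op z := by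
  unfold restrict
  split_ifs <;> rfl

lemma total_restrict (P : Prop) [Decidable P] (y : X) :
    (S.restrict P y).total = if P then S.total else ∑ a, S.lam y a := by
  unfold restrict
  split_ifs
  · exact S.total_reindex _
  · rw [total_reindex, total_single]

lemma renyi_restrict (P : Prop) [Decidable P] (y : X) (s : ℝ) :
    (S.restrict P y).renyi s = if P then S.renyi s else ∑ a, S.lam y a := by
  unfold restrict
  split_ifs
  · exact S.renyi_reindex _ s
  · rw [renyi_reindex, renyi_single]

end SpectralFamily

/-! ### Substrings -/

section Substring

variable {n : ℕ}

lemma restrictPad_congr {x y : BitString n} {T : Finset (Fin n)} (h : ∀ i ∈ T, x i = y i) :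
    restrictPad x T = restrictPad y T := by
  funext j
  unfold restrictPad
  split_ifs with hj
  · exact h _ (T.orderEmbOfFin_mem rfl _)
  · rfl

lemma eq_of_restrictPad_eq {x y : BitString n} {T : Finset (Fin n)}
    (h : restrictPad x T = restrictPad y T) : ∀ i ∈ T, x i = y i := by
  intro i hi
  set j := (T.orderIsoOfFin rfl).symm ⟨i, hi⟩ with hj
  have hT : T.card ≤ n := by simpa using T.card_le_univ
  have h1 := congrFun h ⟨j, j.2.trans_le hT⟩
  have h2 : T.orderEmbOfFin rfl j = i := by
    rw [← Finset.coe_orderIsoOfFin_apply, hj, OrderIso.apply_symm_apply]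
  unfold restrictPad at h1
  simp only [j.2, dif_pos, Fin.eta] at h1
  rwa [h2] at h1

/-- The strings which vanish on `T`. -/
def zeroOn (T : Finset (Fin n)) : Finset (BitString n) :=
  Fintype.piFinset fun i => if i ∈ T then {0} else Finset.univ

/-- Strings are grouped by their values off T. The representative y vanishes on T and records these
values; the inner sum lets the bits in T run freely. -/
lemma sum_bitString_eq {M : Type*} [AddCommMonoid M] (T : Finset (Fin n)) (F : BitString n → M) :
    ∑ x, F x = ∑ y ∈ zeroOn T, ∑ x : ∀ i, {z : Fin 2 // i ∈ T ∨ z = y i}, F fun i => x i := by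
  rw [Finset.sum_sigma']
  refine Finset.sum_bij'
    (i := fun x _ => ⟨fun i => if i ∈ T then 0 else x i,
      fun i => ⟨x i, by by_cases h : i ∈ T <;> simp [h]⟩⟩)
    (j := fun p _ => fun i => (p.2 i).1) ?_ ?_ ?_ ?_ ?_
  · intro x _
    simp only [Finset.mem_sigma, Finset.mem_univ, and_true, zeroOn, Fintype.mem_piFinset]
    intro i
    by_cases h : i ∈ T <;> simp [h]
  · intro p _
    simp
  · intro x _
    rfl
  · rintro ⟨y, x⟩ hy
    simp only [Finset.mem_sigma, Finset.mem_univ, and_true, zeroOn, Fintype.mem_piFinset] at hy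
    have e : (fun i => if i ∈ T then 0 else (x i).1) = y := by
      funext i
      have := hy i
      by_cases h : i ∈ T
      · simp only [h, if_true, Finset.mem_singleton] at this ⊢
        exact this.symm
      · simp only [h, if_false]
        exact (x i).2.resolve_left h
    -- The type of the second component depends on y, so the equation y' = y is substituted before
    -- the components are compared.
    have key : ∀ (y' : BitString n) (_ : y' = y) (x' : ∀ i, {z : Fin 2 // i ∈ T ∨ z = y' i}),
        (∀ i, (x' i).1 = (x i).1) →
        (⟨y', x'⟩ : Σ y : BitString n, ∀ i, {z : Fin 2 // i ∈ T ∨ z = y i}) = ⟨y, x⟩ := by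
      rintro y' rfl x' hx
      congr 1
      funext i
      exact Subtype.ext (hx i)
    exact key _ e _ fun _ => rfl
  · intro x _
    rfl

end Substring

/-! ### Hashing a substring of a product state -/

section SubstringHash

lemma mem_positions {n : ℕ} {θ : Fin n → Basis} {b : Basis} {i : Fin n} :
    i ∈ positions θ b ↔ θ i = b := by
  simp [positions]

variable {n ℓ : ℕ} {d : Fin n → ℕ}

/-- Among strings with the same values off T, restriction to T is injective, so distinct strings
give the hash function distinct inputs. -/
lemma collisionBound_substring {𝓕 : Finset (BitString n → BitString ℓ)} (h𝓕 : 𝓕.Nonempty)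
    (hU : TwoUniversal 𝓕) (T : Finset (Fin n)) (y : BitString n) :
    CollisionBound fun (φ : 𝓕) (x : ∀ i, {z : Fin 2 // i ∈ T ∨ z = y i}) =>
      φ.1 (restrictPad (fun i => (x i).1) T) := by
  intro x x' hx
  have hne : restrictPad (fun i => (x i).1) T ≠ restrictPad (fun i => (x' i).1) T := by
    intro h
    refine hx (funext fun i => Subtype.ext ?_)
    by_cases hi : i ∈ T
    · exact eq_of_restrictPad_eq h i hi
    · rw [(x i).2.resolve_left hi, (x' i).2.resolve_left hi]
  have h := hU _ _ hne
  have hc : (0 : ℝ) < 𝓕.card := by exact_mod_cast h𝓕.card_pos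
  rw [div_le_iff₀ hc] at h
  have hcard : (Finset.univ.filter fun φ : 𝓕 => φ.1 (restrictPad (fun i => (x i).1) T) =
      φ.1 (restrictPad (fun i => (x' i).1) T)).card =
      (𝓕.filter fun f => f (restrictPad (fun i => (x i).1) T) =
        f (restrictPad (fun i => (x' i).1) T)).card := by
    rw [← Finset.card_map (Function.Embedding.subtype (· ∈ 𝓕))]
    congr 1
    ext f
    simp only [Finset.mem_map, Finset.mem_filter, Finset.mem_univ, true_and,
      Function.Embedding.coe_subtype, Subtype.exists, exists_and_right, exists_eq_right]
    exact ⟨fun ⟨h1, h2⟩ => ⟨h1, h2⟩, fun ⟨h1, h2⟩ => ⟨h1, h2⟩⟩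
  rw [hcard]
  simpa [mul_comm] using h

/-- For each y, privacy amplification is applied to the product family whose rounds off T are frozen
at the bits of y. Summing over y afterwards restores the full traces of those rounds. -/
lemma sum_traceNorm_substring_hash_le {𝓕 : Finset (BitString n → BitString ℓ)}
    (h𝓕 : 𝓕.Nonempty) (hU : TwoUniversal 𝓕) (S : ∀ i, SpectralFamily (Fin 2) (Fin (d i)))
    (T : Finset (Fin n)) {s : ℝ} (hs : 0 ≤ s) (hs1 : s ≤ 1) :
    ∑ φ : 𝓕, ∑ u, ∑ y ∈ zeroOn T, traceNorm
      (∑ x : ∀ i, {z : Fin 2 // i ∈ T ∨ z = y i},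
        (hashCoeff (φ.1 (restrictPad (fun i => (x i).1) T)) u : ℂ) •
          tensorFamily fun i => (S i).op (x i)) ≤
      𝓕.card * ((2 + Real.sqrt 2) * (Real.sqrt ((2 ^ ℓ : ℝ) ^ s) *
        ∏ i, if i ∈ T then Real.sqrt ((S i).total * (S i).renyi s) else (S i).total)) := by
  have hy : ∀ y : BitString n, ∑ φ : 𝓕, ∑ u, traceNorm
      (∑ x : ∀ i, {z : Fin 2 // i ∈ T ∨ z = y i},
        (hashCoeff (φ.1 (restrictPad (fun i => (x i).1) T)) u : ℂ) •
          tensorFamily fun i => (S i).op (x i)) ≤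
      𝓕.card * ((2 + Real.sqrt 2) * (Real.sqrt ((2 ^ ℓ : ℝ) ^ s) *
        ∏ i, if i ∈ T then Real.sqrt ((S i).total * (S i).renyi s) else
          ∑ a, (S i).lam (y i) a)) := by
    intro y
    have h := (SpectralFamily.tensor fun i => (S i).restrict (i ∈ T) (y i)).sum_traceNorm_hash_le
      (collisionBound_substring h𝓕 hU T y) hs hs1
    simp only [SpectralFamily.op_tensor, SpectralFamily.op_restrict, SpectralFamily.total_tensor,
      SpectralFamily.renyi_tensor, SpectralFamily.total_restrict,
      SpectralFamily.renyi_restrict] at h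
    refine h.trans (le_of_eq ?_)
    rw [← Finset.prod_mul_distrib, Real.sqrt_mul (by positivity), Fintype.card_coe]
    simp only [Fintype.card_fun, Fintype.card_fin, Nat.cast_pow, Nat.cast_ofNat]
    congr 3
    have hnn : ∀ i, 0 ≤ ∑ a, (S i).lam (y i) a := fun i =>
      Finset.sum_nonneg fun a _ => (S i).lam_nonneg _ a
    -- Off T the total and the Rényi quantity coincide, so their product is a perfect square.
    have e : ∏ i, ((if i ∈ T then (S i).total else ∑ a, (S i).lam (y i) a) *
        if i ∈ T then (S i).renyi s else ∑ a, (S i).lam (y i) a) =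
        (∏ i, if i ∈ T then Real.sqrt ((S i).total * (S i).renyi s) else
          ∑ a, (S i).lam (y i) a) ^ 2 := by
      rw [← Finset.prod_pow]
      refine Finset.prod_congr rfl fun i _ => ?_
      split_ifs
      · rw [Real.sq_sqrt (mul_nonneg (S i).total_nonneg ((S i).renyi_nonneg s))]
      · rw [sq]
    rw [e, Real.sqrt_sq]
    refine Finset.prod_nonneg fun i _ => ?_
    split_ifs
    · exact Real.sqrt_nonneg _
    · exact hnn i
  calc _ = ∑ y ∈ zeroOn T, ∑ φ : 𝓕, ∑ u, traceNorm
          (∑ x : ∀ i, {z : Fin 2 // i ∈ T ∨ z = y i},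
            (hashCoeff (φ.1 (restrictPad (fun i => (x i).1) T)) u : ℂ) •
              tensorFamily fun i => (S i).op (x i)) := by
        rw [Finset.sum_congr rfl fun φ _ => Finset.sum_comm, Finset.sum_comm]
    _ ≤ ∑ y ∈ zeroOn T, 𝓕.card * ((2 + Real.sqrt 2) * (Real.sqrt ((2 ^ ℓ : ℝ) ^ s) *
        ∏ i, if i ∈ T then Real.sqrt ((S i).total * (S i).renyi s) else
          ∑ a, (S i).lam (y i) a)) := Finset.sum_le_sum fun y _ => hy y
    _ = _ := by
        simp_rw [← Finset.mul_sum]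
        congr 3
        -- The sum over y factorizes: a round in T has the single choice 0, a round off T sums both
        -- traces to `total`.
        rw [zeroOn, ← Finset.prod_univ_sum (fun i => if i ∈ T then {0} else Finset.univ)
          (fun i z => if i ∈ T then Real.sqrt ((S i).total * (S i).renyi s) else
            ∑ a, (S i).lam z a)]
        refine Finset.prod_congr rfl fun i _ => ?_
        by_cases h : i ∈ T
        · simp [h]
        · simp [h, SpectralFamily.total]

/-- Hashing the substring on `T` yields an almost uniform string, even given a function of the
remaining substring. -/
lemma sum_traceNorm_hash_of_disjoint_le {Y : Type} [Fintype Y] [DecidableEq Y]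
    {𝓕 : Finset (BitString n → BitString ℓ)}
    (h𝓕 : 𝓕.Nonempty) (hU : TwoUniversal 𝓕) (S : ∀ i, SpectralFamily (Fin 2) (Fin (d i)))
    (T : Finset (Fin n)) {s : ℝ} (hs : 0 ≤ s) (hs1 : s ≤ 1) {h : BitString n → Y}
    (hh : ∀ x y, (∀ i, i ∉ T → x i = y i) → h x = h y) :
    ∑ φ : 𝓕, ∑ u, ∑ v, traceNorm (∑ x : BitString n,
        (if h x = v then (hashCoeff (φ.1 (restrictPad x T)) u : ℂ) else 0) •
          tensorFamily fun i => (S i).op (x i)) ≤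
      𝓕.card * ((2 + Real.sqrt 2) * (Real.sqrt ((2 ^ ℓ : ℝ) ^ s) *
        ∏ i, if i ∈ T then Real.sqrt ((S i).total * (S i).renyi s) else (S i).total)) := by
  refine le_trans ?_ (sum_traceNorm_substring_hash_le h𝓕 hU S T hs hs1)
  refine Finset.sum_le_sum fun φ _ => Finset.sum_le_sum fun u _ => ?_
  set G : BitString n → Matrix (∀ i, Fin (d i)) (∀ i, Fin (d i)) ℂ := fun y =>
    ∑ x : ∀ i, {z : Fin 2 // i ∈ T ∨ z = y i},
        (hashCoeff (φ.1 (restrictPad (fun i => (x i).1) T)) u : ℂ) •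
          tensorFamily fun i => (S i).op (x i) with hG
  -- The value of h is constant on each group, so each group y occurs for exactly one v and
  -- conditioning on h costs nothing.
  have hv : ∀ v, ∑ x : BitString n,
        (if h x = v then (hashCoeff (φ.1 (restrictPad x T)) u : ℂ) else 0) •
          tensorFamily (fun i => (S i).op (x i)) =
      ∑ y ∈ zeroOn T, if h y = v then G y else 0 := by
    intro v
    rw [sum_bitString_eq T]
    refine Finset.sum_congr rfl fun y _ => ?_
    have hxy : ∀ x : ∀ i, {z : Fin 2 // i ∈ T ∨ z = y i}, h (fun i => (x i).1) = h y :=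
      fun x => hh _ _ fun i hi => (x i).2.resolve_left hi
    simp_rw [hxy]
    split_ifs
    · rfl
    · simp
  calc _ ≤ ∑ v, ∑ y ∈ zeroOn T, (if h y = v then traceNorm (G y) else 0) := by
        refine Finset.sum_le_sum fun v _ => ?_
        rw [hv]
        refine (traceNorm_sum_le _ _).trans (Finset.sum_le_sum fun y _ => ?_)
        split_ifs
        · exact le_rfl
        · exact traceNorm_zero.le
    _ = _ := by
        rw [Finset.sum_comm]
        simp only [Finset.sum_ite_eq, Finset.mem_univ, if_true]
        rfl

end SubstringHash

/-! ### The choice of the basis -/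

/-- Cauchy-Schwarz twice. The first root comes from the geometric mean of the two leakages, the
second from privacy amplification. -/
lemma sum_sqrt_mul_sqrt_le_sqrt_sqrt {ι : Type} [Fintype ι] {p q : ι → ℝ} (hp : ∀ j, 0 ≤ p j)
    (hq : ∀ j, 0 ≤ q j) (h1 : ∑ j, p j = 1) :
    ∑ j, Real.sqrt (p j * Real.sqrt (p j * q j)) ≤ Real.sqrt (Real.sqrt (∑ j, q j)) := by
  calc ∑ j, Real.sqrt (p j * Real.sqrt (p j * q j))
      = ∑ j, Real.sqrt (p j) * Real.sqrt (Real.sqrt (p j * q j)) :=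
        Finset.sum_congr rfl fun j _ => Real.sqrt_mul (hp j) _
    _ ≤ Real.sqrt (∑ j, p j) * Real.sqrt (∑ j, Real.sqrt (p j * q j)) :=
        Real.sum_sqrt_mul_sqrt_le _ hp fun j => Real.sqrt_nonneg _
    _ = Real.sqrt (∑ j, Real.sqrt (p j) * Real.sqrt (q j)) := by
        rw [h1, Real.sqrt_one, one_mul]
        congr 1
        exact Finset.sum_congr rfl fun j _ => Real.sqrt_mul (hp j) _
    _ ≤ Real.sqrt (Real.sqrt (∑ j, p j) * Real.sqrt (∑ j, q j)) :=
        Real.sqrt_le_sqrt (Real.sum_sqrt_mul_sqrt_le _ hp hq)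
    _ = _ := by rw [h1, Real.sqrt_one, one_mul]

namespace IndividualStorageAttack

variable {n ℓ : ℕ} {𝓕 : Finset (BitString n → BitString ℓ)} (A : IndividualStorageAttack 𝓕)

/-- The weight of the bases `θ` and outcomes `k` in the bound on the non-uniformity of the hash
value of the substring on the positions with basis different from `b`. -/
def leakage (s : ℝ) (θ : Fin n → Basis) (k : ∀ i, Fin (A.outcomes i)) (b : Basis) : ℝ :=
  ∏ i, if i ∈ positions θ b.other then
    Real.sqrt ((A.roundFamily i (θ i) (k i)).total * (A.roundFamily i (θ i) (k i)).renyi s)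
    else (A.roundFamily i (θ i) (k i)).total

/-- The basis with the smaller leakage about the substring of the other basis. -/
def chosenBasis (s : ℝ) (θ : Fin n → Basis) (k : ∀ i, Fin (A.outcomes i)) : Basis :=
  if A.leakage s θ k .plus ≤ A.leakage s θ k .cross then .plus else .cross

lemma leakage_nonneg (s : ℝ) (θ : Fin n → Basis) (k : ∀ i, Fin (A.outcomes i)) (b : Basis) :
    0 ≤ A.leakage s θ k b := by
  refine Finset.prod_nonneg fun i _ => ?_
  split_ifs
  · exact Real.sqrt_nonneg _
  · exact SpectralFamily.total_nonneg _

/-- The smaller of two numbers is at most their geometric mean. In the product of the two leakages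
each round appears once with `total` and once with √(total · renyi), whichever its basis is. -/
lemma leakage_chosenBasis_le (s : ℝ) (θ : Fin n → Basis) (k : ∀ i, Fin (A.outcomes i)) :
    A.leakage s θ k (A.chosenBasis s θ k) ≤
      ∏ i, Real.sqrt ((A.roundFamily i (θ i) (k i)).total * Real.sqrt
        ((A.roundFamily i (θ i) (k i)).total * (A.roundFamily i (θ i) (k i)).renyi s)) := by
  have hp := A.leakage_nonneg s θ k .plus
  have hc := A.leakage_nonneg s θ k .cross
  have hmul : A.leakage s θ k .plus * A.leakage s θ k .cross =
      (∏ i, Real.sqrt ((A.roundFamily i (θ i) (k i)).total * Real.sqrt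
        ((A.roundFamily i (θ i) (k i)).total * (A.roundFamily i (θ i) (k i)).renyi s))) ^ 2 := by
    rw [leakage, leakage, ← Finset.prod_mul_distrib, ← Finset.prod_pow]
    refine Finset.prod_congr rfl fun i _ => ?_
    rw [Real.sq_sqrt (mul_nonneg (SpectralFamily.total_nonneg _) (Real.sqrt_nonneg _))]
    simp only [mem_positions, Basis.other]
    cases θ i <;> simp [mul_comm]
  have hR : 0 ≤ ∏ i, Real.sqrt ((A.roundFamily i (θ i) (k i)).total * Real.sqrt
        ((A.roundFamily i (θ i) (k i)).total * (A.roundFamily i (θ i) (k i)).renyi s)) :=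
    Finset.prod_nonneg fun i _ => Real.sqrt_nonneg _
  unfold chosenBasis
  split_ifs with h
  · refine abs_le_of_sq_le_sq' ?_ hR |>.2
    rw [← hmul, sq]
    gcongr
  · refine abs_le_of_sq_le_sq' ?_ hR |>.2
    rw [← hmul, sq]
    have := (not_le.1 h).le
    gcongr

/-- The chosen basis depends on all rounds jointly, so the sum factorizes only after the leakage has
been replaced by its product bound. -/
lemma sum_leakage_chosenBasis_le {t : ℝ} (ht : A.IsUncertaintyLowerBound t) {s : ℝ} (hs : 0 ≤ s)
    (hs1 : s ≤ 1) :
    ∑ θ, ∑ k, A.leakage s θ k (A.chosenBasis s θ k) ≤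
      Real.exp (n * ((3 * s ^ 2 - s * t * Real.log 2) / 4)) := by
  have hround : ∀ i, ∑ θ, ∑ k, Real.sqrt ((A.roundFamily i θ k).total * Real.sqrt
      ((A.roundFamily i θ k).total * (A.roundFamily i θ k).renyi s)) ≤
      Real.exp ((3 * s ^ 2 - s * t * Real.log 2) / 4) := by
    intro i
    have h := sum_sqrt_mul_sqrt_le_sqrt_sqrt (ι := Basis × Fin (A.outcomes i))
      (p := fun j => (A.roundFamily i j.1 j.2).total)
      (q := fun j => (A.roundFamily i j.1 j.2).renyi s)
      (fun j => SpectralFamily.total_nonneg _) (fun j => SpectralFamily.renyi_nonneg _ s)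
      (by rw [Fintype.sum_prod_type]; exact A.sum_total_roundFamily i)
    rw [Fintype.sum_prod_type, Fintype.sum_prod_type] at h
    refine h.trans ?_
    calc Real.sqrt (Real.sqrt (∑ θ, ∑ k, (A.roundFamily i θ k).renyi s))
        ≤ Real.sqrt (Real.sqrt (Real.exp (3 * s ^ 2 - s * t * Real.log 2))) := by
          gcongr
          exact A.sum_renyi_roundFamily_le ht hs hs1 i
      _ = _ := by
          rw [← Real.exp_half, ← Real.exp_half]
          congr 1
          ring
  calc ∑ θ, ∑ k, A.leakage s θ k (A.chosenBasis s θ k)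
      ≤ ∑ θ : Fin n → Basis, ∑ k : ∀ i, Fin (A.outcomes i),
          ∏ i, Real.sqrt ((A.roundFamily i (θ i) (k i)).total * Real.sqrt
        ((A.roundFamily i (θ i) (k i)).total * (A.roundFamily i (θ i) (k i)).renyi s)) :=
        Finset.sum_le_sum fun θ _ => Finset.sum_le_sum fun k _ => A.leakage_chosenBasis_le s θ k
    _ = ∏ i, ∑ θ, ∑ k, Real.sqrt ((A.roundFamily i θ k).total * Real.sqrt
          ((A.roundFamily i θ k).total * (A.roundFamily i θ k).renyi s)) := by
        rw [Finset.prod_univ_sum, Fintype.piFinset_univ]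
        refine Finset.sum_congr rfl fun θ _ => ?_
        rw [Finset.prod_univ_sum, Fintype.piFinset_univ]
    _ ≤ ∏ i : Fin n, Real.exp ((3 * s ^ 2 - s * t * Real.log 2) / 4) := by
        refine Finset.prod_le_prod (fun i _ => ?_) fun i _ => hround i
        exact Finset.sum_nonneg fun θ _ => Finset.sum_nonneg fun k _ => Real.sqrt_nonneg _
    _ = _ := by
        rw [Finset.prod_const, Finset.card_univ, Fintype.card_fin, ← Real.exp_nat_mul]

end IndividualStorageAttack

/-! ### The non-uniformity of the final state -/

section NonUniformity

variable {a b c e X : Type} [Fintype a] [Fintype b] [Fintype c] [Fintype e] [Fintype X]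
  [DecidableEq a] [DecidableEq c] [DecidableEq e]

lemma sum_smul_cqState {e : Type} (z : X → ℂ) (f : X → c → Matrix e e ℂ) :
    ∑ x, z x • cqState (f x) = cqState fun y => ∑ x, z x • f x y := by
  ext p q
  rw [Matrix.sum_apply]
  simp_rw [Matrix.smul_apply, cqState_apply]
  by_cases h : p.1 = q.1
  · simp [h, Matrix.sum_apply]
  · simp [h]

lemma Channel.apply_sum_smul (N : Channel a b) (z : X → ℂ) (ρ : X → Matrix a a ℂ) :
    N.apply (∑ x, z x • ρ x) = ∑ x, z x • N.apply (ρ x) := by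
  unfold Channel.apply
  simp_rw [Matrix.mul_sum, Matrix.sum_mul, Matrix.mul_smul, Matrix.smul_mul, Finset.smul_sum]
  rw [Finset.sum_comm]

lemma Channel.apply_sum (N : Channel a b) (ρ : X → Matrix a a ℂ) :
    N.apply (∑ x, ρ x) = ∑ x, N.apply (ρ x) := by
  simpa using N.apply_sum_smul (fun _ => 1) ρ

/-- The deviation from uniform is block-diagonal in u, with block ∑ y, `hashCoeff` y u • f y. -/
lemma nonUniformity_le (f : c → Matrix e e ℂ) :
    nonUniformity f ≤ 1 / 2 * ∑ u, traceNorm (∑ y, (hashCoeff y u : ℂ) • f y) := by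
  have h : ((Fintype.card c : ℂ)⁻¹ • (1 : Matrix c c ℂ)) ⊗ₖ (∑ x, f x) - cqState f =
      cqState fun u => ∑ y, (hashCoeff y u : ℂ) • f y := by
    ext ⟨x, i⟩ ⟨y, j⟩
    rw [Matrix.sub_apply, Matrix.kroneckerMap_apply, cqState_apply, cqState_apply,
      Matrix.smul_apply, Matrix.one_apply]
    by_cases hxy : x = y
    · subst hxy
      have e : ∀ y, ((hashCoeff y x : ℝ) : ℂ) = (Fintype.card c : ℂ)⁻¹ - if y = x then 1 else 0 := by
        intro y
        unfold hashCoeff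
        split_ifs <;> simp
      simp only [if_true, smul_eq_mul, mul_one, Matrix.sum_apply, Matrix.smul_apply, e, sub_mul,
        Finset.sum_sub_distrib, Finset.mul_sum, ite_mul, one_mul, zero_mul, Finset.sum_ite_eq',
        Finset.mem_univ]
    · simp [hxy]
  rw [nonUniformity, h]
  gcongr
  exact traceNorm_cqState_le _

end NonUniformity

lemma sum_rotate {α β γ δ ζ η M : Type*} [Fintype α] [Fintype β] [Fintype γ] [Fintype δ]
    [Fintype ζ] [Fintype η] [AddCommMonoid M] (G : α → β → γ → δ → ζ → η → M) :
    ∑ u, ∑ v, ∑ d, ∑ θ, ∑ f, ∑ k, G u v d θ f k = ∑ θ, ∑ k, ∑ u, ∑ v, ∑ f, ∑ d, G u v d θ f k := by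
  have h1 : ∀ u v, ∑ d, ∑ θ, ∑ f, ∑ k, G u v d θ f k = ∑ θ, ∑ k, ∑ f, ∑ d, G u v d θ f k := by
    intro u v
    rw [Finset.sum_comm]
    refine Finset.sum_congr rfl fun θ _ => ?_
    rw [Finset.sum_congr rfl fun d _ => Finset.sum_comm, Finset.sum_comm]
    exact Finset.sum_congr rfl fun k _ => Finset.sum_comm
  simp_rw [h1]
  rw [Finset.sum_congr rfl fun u _ => Finset.sum_comm, Finset.sum_comm]
  refine Finset.sum_congr rfl fun θ _ => ?_
  rw [Finset.sum_congr rfl fun u _ => Finset.sum_comm, Finset.sum_comm]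

lemma sum_basis_fun {H : Type} [Fintype H] [DecidableEq (Basis → H)] {M : Type*} [AddCommMonoid M]
    (b : Basis) (G : H → H → M) : ∑ f : Basis → H, G (f b) (f b.other) = ∑ h, ∑ φ, G h φ := by
  rw [← Fintype.sum_prod_type']
  refine Fintype.sum_equiv
    { toFun := fun f => (f b, f b.other)
      invFun := fun p b' => if b' = b then p.1 else p.2
      left_inv := ?_
      right_inv := ?_ } _ _ fun f => rfl
  · intro f
    funext b'
    cases b <;> cases b' <;> simp [Basis.other]
  · rintro ⟨h, φ⟩
    cases b <;> simp [Basis.other]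

lemma posSemidef_tensorFamily_op {n : ℕ} {d : Fin n → ℕ} {I : Fin n → Type} [∀ i, Fintype (I i)]
    (S : ∀ i, SpectralFamily (I i) (Fin (d i))) (x : ∀ i, I i) :
    (tensorFamily fun i => (S i).op (x i)).PosSemidef := by
  rw [← SpectralFamily.op_tensor S x]
  exact posSemidef_mul_diagonal_mul _ fun a => (SpectralFamily.tensor S).lam_nonneg x a

namespace IndividualStorageAttack

variable {n ℓ : ℕ} {𝓕 : Finset (BitString n → BitString ℓ)} (A : IndividualStorageAttack 𝓕)

lemma op_roundFamily (i : Fin n) (θ : Basis) (k : Fin (A.outcomes i)) (x : Fin 2) :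
    (A.roundFamily i θ k).op x = A.roundOp i x θ k :=
  SpectralFamily.op_ofPosSemidef _ x

/-- The part of `revealedOp` for which the chosen basis is `d`. -/
def chosenOp (D : (Fin n → Basis) → (∀ i, Fin (A.outcomes i)) → Basis) (d : Basis)
    (s : Basis → BitString ℓ) (x : BitString n) :
    Matrix ((Fin n → Basis) × (Basis → 𝓕) × (∀ i, Fin (A.outcomes i)) × (∀ i, Fin (A.storeDim i)))
      ((Fin n → Basis) × (Basis → 𝓕) × (∀ i, Fin (A.outcomes i)) × (∀ i, Fin (A.storeDim i))) ℂ :=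
  cqState fun θ => cqState fun f : Basis → 𝓕 => cqState fun k =>
    if D θ k = d ∧ ∀ b, (f b : BitString n → BitString ℓ) (restrictPad x (positions θ b)) = s b then
      ((𝓕.card : ℂ)⁻¹ ^ 2) • tensorFamily fun i => A.roundOp i (x i) (θ i) (k i)
    else 0

lemma sum_chosenOp (D : (Fin n → Basis) → (∀ i, Fin (A.outcomes i)) → Basis)
    (s : Basis → BitString ℓ) (x : BitString n) : ∑ d, A.chosenOp D d s x = A.revealedOp s x := by
  unfold chosenOp revealedOp
  rw [sum_cqState]
  refine congrArg cqState (funext fun θ => ?_)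
  rw [sum_cqState]
  refine congrArg cqState (funext fun f => ?_)
  rw [sum_cqState]
  refine congrArg cqState (funext fun k => ?_)
  by_cases h : ∀ b, (f b : BitString n → BitString ℓ) (restrictPad x (positions θ b)) = s b
  · simp only [h, implies_true, and_true, if_true, Finset.sum_ite_eq, Finset.mem_univ]
  · simp only [h, and_false, if_false, Finset.sum_const_zero]

lemma posSemidef_chosenOp (D : (Fin n → Basis) → (∀ i, Fin (A.outcomes i)) → Basis) (d : Basis)
    (s : Basis → BitString ℓ) (x : BitString n) : (A.chosenOp D d s x).PosSemidef := by
  refine posSemidef_cqState fun θ => posSemidef_cqState fun f => posSemidef_cqState fun k => ?_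
  split_ifs
  · refine Matrix.PosSemidef.smul ?_ (by positivity)
    have := posSemidef_tensorFamily_op (fun i => A.roundFamily i (θ i) (k i)) x
    simpa only [op_roundFamily] using this
  · exact Matrix.PosSemidef.zero

/-- The joint state of the chosen basis, the sender's outputs and the receiver's system. -/
def chosenState (D : (Fin n → Basis) → (∀ i, Fin (A.outcomes i)) → Basis) (d : Basis)
    (s : Basis → BitString ℓ) : Matrix (Fin A.finalDim) (Fin A.finalDim) ℂ :=
  A.final.apply (∑ x, A.chosenOp D d s x)

lemma sum_chosenState (D : (Fin n → Basis) → (∀ i, Fin (A.outcomes i)) → Basis)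
    (s : Basis → BitString ℓ) : ∑ d, A.chosenState D d s = A.finalState s := by
  unfold chosenState finalState
  rw [← Channel.apply_sum, Finset.sum_comm]
  simp_rw [sum_chosenOp]

lemma posSemidef_chosenState (D : (Fin n → Basis) → (∀ i, Fin (A.outcomes i)) → Basis) (d : Basis)
    (s : Basis → BitString ℓ) : (A.chosenState D d s).PosSemidef :=
  posSemidef_sum_kraus _ (Matrix.posSemidef_sum _ fun x _ => A.posSemidef_chosenOp D d s x)

/-- The deviation from uniform of the hash value of the substring on the positions with basis
different from `b`, for given bases, outcomes and hash functions. -/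
def hashDeviation (θ : Fin n → Basis) (k : ∀ i, Fin (A.outcomes i)) (b : Basis) (v u : BitString ℓ)
    (h φ : 𝓕) : Matrix (∀ i, Fin (A.storeDim i)) (∀ i, Fin (A.storeDim i)) ℂ :=
  ∑ x : BitString n, (if h.1 (restrictPad x (positions θ b)) = v then
    (hashCoeff (φ.1 (restrictPad x (positions θ b.other))) u : ℂ) else 0) •
      tensorFamily fun i => A.roundOp i (x i) (θ i) (k i)

lemma sum_traceNorm_hashDeviation_le (h𝓕 : 𝓕.Nonempty) (hU : TwoUniversal 𝓕)
    {s : ℝ} (hs : 0 ≤ s) (hs1 : s ≤ 1) (θ : Fin n → Basis) (k : ∀ i, Fin (A.outcomes i))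
    (b : Basis) :
    ∑ h : 𝓕, ∑ φ : 𝓕, ∑ u, ∑ v, traceNorm (A.hashDeviation θ k b v u h φ) ≤
      (𝓕.card : ℝ) ^ 2 * ((2 + Real.sqrt 2) *
        (Real.sqrt ((2 ^ ℓ : ℝ) ^ s) * A.leakage s θ k b)) := by
  have hh : ∀ h : 𝓕, ∑ φ : 𝓕, ∑ u, ∑ v, traceNorm (A.hashDeviation θ k b v u h φ) ≤
      𝓕.card * ((2 + Real.sqrt 2) * (Real.sqrt ((2 ^ ℓ : ℝ) ^ s) * A.leakage s θ k b)) := by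
    intro h
    have := sum_traceNorm_hash_of_disjoint_le h𝓕 hU (fun i => A.roundFamily i (θ i) (k i))
      (positions θ b.other) hs hs1 (h := fun x => h.1 (restrictPad x (positions θ b)))
      -- The positions of the two bases are disjoint, so the other string is a function of the bits
      -- that are not being hashed.
      (fun x y hxy => congrArg h.1 (restrictPad_congr fun i hi => hxy i fun hi' => by
        rw [mem_positions] at hi hi'
        rw [hi] at hi'
        cases b <;> simp [Basis.other] at hi'))
    simp only [op_roundFamily] at this
    exact this
  refine (Finset.sum_le_sum fun h _ => hh h).trans (le_of_eq ?_)
  rw [Finset.sum_const, Finset.card_univ, Fintype.card_coe, nsmul_eq_mul]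
  ring

/-- All classical registers split into blocks, and the final operation contracts the trace norm.
What remains is the average of the hash deviation over the two functions, with D determined by θ and
k. -/
lemma nonUniformity_chosenState_le (h𝓕 : 𝓕.Nonempty) (hU : TwoUniversal 𝓕)
    (D : (Fin n → Basis) → (∀ i, Fin (A.outcomes i)) → Basis) {s : ℝ} (hs : 0 ≤ s) (hs1 : s ≤ 1) :
    nonUniformity (otherGivenChosen (A.chosenState D)) ≤
      1 / 2 * ((2 + Real.sqrt 2) *
        (Real.sqrt ((2 ^ ℓ : ℝ) ^ s) * ∑ θ, ∑ k, A.leakage s θ k (D θ k))) := by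
  have hc : (𝓕.card : ℝ) ≠ 0 := by exact_mod_cast h𝓕.card_pos.ne'
  -- Summing over y collapses the condition on the other string: y becomes the hash value itself
  -- inside `hashCoeff`.
  have hterm : ∀ (u v : BitString ℓ) (d : Basis) (θ : Fin n → Basis) (f : Basis → 𝓕)
      (k : ∀ i, Fin (A.outcomes i)),
      ∑ y, (hashCoeff y u : ℂ) • ∑ x, (if D θ k = d ∧
        ∀ b, (f b).1 (restrictPad x (positions θ b)) = (if b = d then v else y) then
          ((𝓕.card : ℂ)⁻¹ ^ 2) • tensorFamily (fun i => A.roundOp i (x i) (θ i) (k i)) else 0) =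
      if D θ k = d then
        ((𝓕.card : ℂ)⁻¹ ^ 2) • A.hashDeviation θ k d v u (f d) (f d.other) else 0 := by
    intro u v d θ f k
    have hcond : ∀ (x : BitString n) (y : BitString ℓ),
        (∀ b, (f b).1 (restrictPad x (positions θ b)) = (if b = d then v else y)) ↔
        (f d).1 (restrictPad x (positions θ d)) = v ∧
          (f d.other).1 (restrictPad x (positions θ d.other)) = y := by
      intro x y
      constructor
      · intro h
        refine ⟨by simpa using h d, ?_⟩
        have := h d.other
        rwa [if_neg (by cases d <;> simp [Basis.other])] at this
      · rintro ⟨h1, h2⟩ b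
        by_cases hb : b = d
        · subst hb; simpa using h1
        · rw [if_neg hb]
          have : b = d.other := by cases b <;> cases d <;> simp_all [Basis.other]
          rw [this]; exact h2
    simp_rw [hcond]
    split_ifs with hD
    · simp only [hD, true_and, hashDeviation]
      simp_rw [Finset.smul_sum]
      rw [Finset.sum_comm]
      refine Finset.sum_congr rfl fun x _ => ?_
      by_cases hv : (f d).1 (restrictPad x (positions θ d)) = v
      · simp only [hv, true_and, if_true, smul_ite, smul_zero, Finset.sum_ite_eq, Finset.mem_univ]
        exact smul_comm _ _ _
      · simp [hv]
    · simp [hD]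
  have hu : ∀ u, ∑ y, (hashCoeff y u : ℂ) • otherGivenChosen (A.chosenState D) y =
      cqState fun v => cqState fun d => A.final.apply (cqState fun θ => cqState fun f : Basis → 𝓕 =>
        cqState fun k => if D θ k = d then
        ((𝓕.card : ℂ)⁻¹ ^ 2) • A.hashDeviation θ k d v u (f d) (f d.other) else 0) := by
    intro u
    unfold otherGivenChosen
    simp_rw [sum_smul_cqState]
    congr 1
    funext v
    congr 1
    funext d
    unfold chosenState chosenOp
    rw [← Channel.apply_sum_smul]
    congr 1
    simp_rw [sum_cqState, sum_smul_cqState]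
    congr 1
    funext θ
    congr 1
    funext f
    congr 1
    funext k
    exact hterm u v d θ f k
  have hbound : ∀ u, traceNorm (∑ y, (hashCoeff y u : ℂ) • otherGivenChosen (A.chosenState D) y) ≤
      ∑ v, ∑ d, ∑ θ, ∑ f : Basis → 𝓕, ∑ k, if D θ k = d then
        ((𝓕.card : ℝ)⁻¹ ^ 2) * traceNorm (A.hashDeviation θ k d v u (f d) (f d.other)) else 0 := by
    intro u
    rw [hu]
    refine (traceNorm_cqState_le _).trans (Finset.sum_le_sum fun v _ => ?_)
    refine (traceNorm_cqState_le _).trans (Finset.sum_le_sum fun d _ => ?_)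
    refine (traceNorm_channel_le _ _).trans ?_
    refine (traceNorm_cqState_le _).trans (Finset.sum_le_sum fun θ _ => ?_)
    refine (traceNorm_cqState_le _).trans (Finset.sum_le_sum fun f _ => ?_)
    refine (traceNorm_cqState_le _).trans (Finset.sum_le_sum fun k _ => ?_)
    split_ifs
    · refine (traceNorm_smul_le _ _).trans (le_of_eq ?_)
      simp
    · exact traceNorm_zero.le
  refine (nonUniformity_le _).trans ?_
  refine mul_le_mul_of_nonneg_left ?_ (by norm_num)
  calc _ ≤ ∑ u, ∑ v, ∑ d, ∑ θ, ∑ f : Basis → 𝓕, ∑ k, (if D θ k = d then ((𝓕.card : ℝ)⁻¹ ^ 2) *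
            traceNorm (A.hashDeviation θ k d v u (f d) (f d.other)) else 0) :=
        Finset.sum_le_sum fun u _ => hbound u
    _ = ∑ θ, ∑ k, ∑ u, ∑ v, ∑ f : Basis → 𝓕, ∑ d, (if D θ k = d then ((𝓕.card : ℝ)⁻¹ ^ 2) *
            traceNorm (A.hashDeviation θ k d v u (f d) (f d.other)) else 0) := by
        exact sum_rotate _
    _ = ∑ θ, ∑ k, ((𝓕.card : ℝ)⁻¹ ^ 2) * ∑ h : 𝓕, ∑ φ : 𝓕, ∑ u, ∑ v,
          traceNorm (A.hashDeviation θ k (D θ k) v u h φ) := by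
        refine Finset.sum_congr rfl fun θ _ => Finset.sum_congr rfl fun k _ => ?_
        simp only [Finset.sum_ite_eq, Finset.mem_univ, if_true]
        -- A pair of hash functions is listed as chosen one first, other one second, so the average
        -- does not depend on which basis was chosen.
        rw [← sum_basis_fun (D θ k) fun h φ => ∑ u, ∑ v,
          traceNorm (A.hashDeviation θ k (D θ k) v u h φ)]
        simp_rw [← Finset.mul_sum]
        congr 1
        rw [Finset.sum_congr rfl fun u _ => Finset.sum_comm, Finset.sum_comm]
    _ ≤ ∑ θ, ∑ k, ((𝓕.card : ℝ)⁻¹ ^ 2) * ((𝓕.card : ℝ) ^ 2 * ((2 + Real.sqrt 2) *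
        (Real.sqrt ((2 ^ ℓ : ℝ) ^ s) * A.leakage s θ k (D θ k)))) := by
        gcongr with θ _ k _
        exact A.sum_traceNorm_hashDeviation_le h𝓕 hU hs hs1 θ k (D θ k)
    _ = _ := by
        simp_rw [Finset.mul_sum]
        refine Finset.sum_congr rfl fun θ _ => Finset.sum_congr rfl fun k _ => ?_
        rw [← mul_assoc, ← mul_pow, inv_mul_cancel₀ hc, one_pow, one_mul]

/-- Security with an error in terms of a Rényi parameter `s`. -/
lemma secureAgainstReceiver_finalState (h𝓕 : 𝓕.Nonempty) (hU : TwoUniversal 𝓕) {t : ℝ}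
    (ht : A.IsUncertaintyLowerBound t) {s : ℝ} (hs : 0 ≤ s) (hs1 : s ≤ 1) :
    SecureAgainstReceiver A.finalState (1 / 2 * ((2 + Real.sqrt 2) *
      Real.exp (s * ℓ * Real.log 2 / 2 + n * ((3 * s ^ 2 - s * t * Real.log 2) / 4)))) := by
  refine ⟨A.chosenState (A.chosenBasis s), A.posSemidef_chosenState _, A.sum_chosenState _,
    (A.nonUniformity_chosenState_le h𝓕 hU (A.chosenBasis s) hs hs1).trans ?_⟩
  have e : Real.sqrt ((2 ^ ℓ : ℝ) ^ s) = Real.exp (s * ℓ * Real.log 2 / 2) := by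
    rw [Real.exp_half, Real.rpow_def_of_pos (by positivity), Real.log_pow]
    congr 2
    ring
  rw [Real.exp_add, e]
  gcongr
  exact A.sum_leakage_chosenBasis_le ht hs hs1

end IndividualStorageAttack

/-! ### The choice of the Rényi order and the final estimate. -/

lemma SecureAgainstReceiver.mono {ℓ m : ℕ} {ρ : (Basis → BitString ℓ) → Matrix (Fin m) (Fin m) ℂ}
    {ε ε' : ℝ} (h : SecureAgainstReceiver ρ ε) (hε : ε ≤ ε') : SecureAgainstReceiver ρ ε' := by
  obtain ⟨σ, h1, h2, h3⟩ := h
  exact ⟨σ, h1, h2, h3.trans hε⟩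

/-- Write r = √(L/n), e = log(1/ε), so that L = r²n = 1 + 4e, and take s = r/4. A quarter of the
length bound times r ln 2 eliminates t; then δ = 8r contributes -(L ln 2)/2. Half of this equals -e
ln 2 - (ln 2)/4, and the other half absorbs the second-order term 3L/64. The leftover (r ln 2)/8 is
covered by (ln 2)/4. -/
lemma error_exponent_le {n ℓ t ε L : ℝ} (hℓ0 : 0 ≤ ℓ) (hε : 0 < ε) (hε1 : ε < 1)
    (hL : L = Real.logb 2 (2 / ε ^ 4)) (hn : n ≥ 8 / 5 * L)
    (hℓ : ℓ ≤ 1 / 4 * (t - 8 * Real.sqrt (L / n)) * n + 1 / 2 - Real.logb 2 (1 / ε)) :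
    ∃ s : ℝ, 0 ≤ s ∧ s ≤ 1 ∧
      s * ℓ * Real.log 2 / 2 + n * ((3 * s ^ 2 - s * t * Real.log 2) / 4) ≤ Real.log ε := by
  have hl2 : 0 < Real.log 2 := Real.log_pos one_lt_two
  have hl2' : 0.69 < Real.log 2 := lt_trans (by norm_num) Real.log_two_gt_d9
  set e : ℝ := Real.logb 2 (1 / ε) with he
  have he0 : 0 < e := Real.logb_pos one_lt_two (by rw [lt_div_iff₀ hε]; linarith)
  have hLe : L = 1 + 4 * e := by
    rw [hL, he, Real.logb_div (by norm_num) (by positivity), Real.logb_div one_ne_zero hε.ne',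
      Real.logb_pow, Real.logb_self_eq_one one_lt_two, Real.logb_one]
    push_cast
    ring
  have heε : Real.log ε = -e * Real.log 2 := by
    rw [he, Real.logb_div one_ne_zero hε.ne', Real.logb_one, Real.logb]
    field_simp
    ring
  have hL0 : 0 < L := by linarith
  have hn0 : 0 < n := by linarith
  set r : ℝ := Real.sqrt (L / n) with hr
  have hr0 : 0 ≤ r := Real.sqrt_nonneg _
  have hr2 : r ^ 2 * n = L := by
    rw [hr, Real.sq_sqrt (by positivity)]
    field_simp
  -- The lower bound on n gives r² ≤ 5/8, which is below 16/25.
  have hr1 : r ≤ 4 / 5 := by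
    rw [hr]
    refine Real.sqrt_le_iff.2 ⟨by norm_num, ?_⟩
    rw [div_le_iff₀ hn0]
    linarith
  refine ⟨r / 4, by positivity, by linarith, ?_⟩
  have h1 := mul_le_mul_of_nonneg_left hℓ (mul_nonneg hr0 hl2.le)
  have h2 : 0 ≤ r * Real.log 2 * ℓ := by positivity
  have h3 : 0 ≤ r * Real.log 2 * e := by positivity
  have h4 : r * Real.log 2 ≤ 4 / 5 * Real.log 2 := by gcongr
  have h5 : 0.69 * L ≤ Real.log 2 * L := by gcongr
  rw [heε]
  have h6 : r * Real.log 2 * (r * n) = Real.log 2 * L := by rw [← hr2]; ring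
  have h7 : Real.log 2 * L = Real.log 2 + 4 * (e * Real.log 2) := by rw [hLe]; ring
  have h8 : n * (3 * (r / 4) ^ 2) = 3 / 16 * L := by rw [← hr2]; ring
  nlinarith

end NoisyStorage

end

theorem theorem1 {n ℓ : ℕ} (𝓕 : Finset (NoisyStorage.BitString n → NoisyStorage.BitString ℓ))
    (h𝓕 : 𝓕.Nonempty) (hU : NoisyStorage.TwoUniversal 𝓕)
    (A : NoisyStorage.IndividualStorageAttack 𝓕) (t : ℝ) (ht : A.IsUncertaintyLowerBound t)
    (ε : ℝ) (hε : 0 < ε)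
    (hn : (n : ℝ) ≥ 8 / 5 * Real.logb 2 (2 / ε ^ 4))
    (hℓ : (ℓ : ℝ) ≤ 1 / 4 * (t - 8 * Real.sqrt (Real.logb 2 (2 / ε ^ 4) / n)) * n + 1 / 2
      - Real.logb 2 (1 / ε)) :
    NoisyStorage.SecureAgainstReceiver A.finalState (2 * ε) := by
  -- Rounds the constant (2 + √2)/2 up to the 2 of the error 2ε.
  have h2 : Real.sqrt 2 ≤ 2 := Real.sqrt_le_iff.2 ⟨by norm_num, by norm_num⟩
  rcases lt_or_ge ε 1 with hε1 | hε1
  · obtain ⟨s, hs, hs1, h⟩ := NoisyStorage.error_exponent_le (Nat.cast_nonneg ℓ) hε hε1 rfl hn hℓ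
    refine (A.secureAgainstReceiver_finalState h𝓕 hU ht hs hs1).mono ?_
    have hexp := Real.exp_le_exp.2 h
    rw [Real.exp_log hε] at hexp
    calc _ ≤ 1 / 2 * ((2 + 2) * ε) := by gcongr
      _ = 2 * ε := by ring
  -- For ε ≥ 1 the choice s = 0 makes the exponent vanish, and (2 + √2)/2 ≤ 2 ≤ 2ε.
  · refine (A.secureAgainstReceiver_finalState h𝓕 hU ht le_rfl zero_le_one).mono ?_
    simp only [zero_mul, ne_eq, OfNat.ofNat_ne_zero, not_false_eq_true, zero_pow, mul_zero,
      zero_div, sub_self, add_zero, Real.exp_zero, mul_one]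
    linarith
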